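/- **Setting.** Let $(X,Y)$ be a random pair with values in $\mathcal X\times\mathbb R$, $\mathbb E Y^2<\infty$, and let $\mu$ be the law of $X$. Let $V$ be a vector space of measurable, $\mu$-square-integrable functions on $\mathcal X$ (for instance a Sobolev space), $\mathscr D:V\to L_2(\mu)$ linear, $g\in L_2(\mu)$, and $\Psi(f)=\lVert \mathscr D f-g\rVert_{L_2(\mu)}$. Let $\mathscr H\subset V$ and let $\mathscr F$ be the closure in $L_2(\mu)$ of the convex hull of $\mathscr H$. Assume that $\mathscr F$ satisfies the small-ball assumption with constants $\kappa>0$ and $0<\epsilon\le 1$: $$\Pr\big(|f(X)-h(X)|\ge\kappa\lVert f-h\rVert_{L_2(\mu)}\big)\ge\epsilon\qquad\text{for all } f,h\in\mathscr F .$$ Assume also that the minimiser $f^\star$ of $\mathbb E(f(X)-Y)^2$ over $f\in\mathscr F$ belongs to $\mathscr H$. Suprema over $\mathscr F$ are assumed measurable. Put $\xi=f^\star(X)-Y$, let $(X_i,Y_i)_{i\le n}$ be independent copies of $(X,Y)$, $\xi_i=f^\star(X_i)-Y_i$, and let $\varepsilon_1,\dots,\varepsilon_n$ be independent uniform signs,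 independent of the sample. For $\mathscr G\subset V$ write $\mathscr G_r=\{f\in\mathscr G:\lVert f-f^\star\rVert_{L_2(\mu)}\le r\}$ and $$r_Q(\mathscr G,\tau)=\inf\Big\{r>0:\mathbb E\sup_{f\in\mathscr G_r}\Big|\tfrac1n\sum_{i=1}^n\varepsilon_i(f-f^\star)(X_i)\Big|\le\tau r\Big\},$$ $$r_M(\mathscr G,\tau,\delta)=\inf\Big\{s>0:\Pr\Big(\sup_{f\in\mathscr G_s}\Big|\tfrac1{\sqrt n}\sum_{i=1}^n\varepsilon_i\xi_i(f-f^\star)(X_i)\Big|\le\tau s^2\sqrt n\Big)\ge1-\delta\Big\}.$$ For $\rho\ge0$ let $\mathscr F(\rho)=\{f\in\mathscr F\cap V:\Psi(f)-\Psi(f^\star)\le\rho\}$. Fix $\delta\in(0,1)$ and a function $r(\cdot)$ such that, for all $\rho\ge 0$, $$r(\rho)\ge\max\{r_M(\mathscr F(\rho),\kappa^2\epsilon/80,\delta/4),\,r_Q(\mathscr F(\rho),\kappa\epsilon/32)\}.$$ Let $$\mathcal O(\rho)=\sup_{f\in\mathscr F(\rho)_{r(\rho)}}\Big|\tfrac1n\sum_{i=1}^n\xi_i(f-f^\star)(X_i)-\mathbb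 E\,\xi(f-f^\star)(X)\Big|,$$ $$\gamma_{\mathcal O}(\rho,\tau,\delta)=\inf\{z>0:\Pr(\mathcal O(\rho)\le\tau z)\ge1-\delta\},\qquad \lambda_0(\delta,\tau)=\sup_{\rho>0}\gamma_{\mathcal O}(\rho,\tau,\delta)/\rho .$$ **Theorem.** Fix $\rho>2\Psi(f^\star)$, $0<\tau<1/2-\Psi(f^\star)/\rho$ and $\lambda>\lambda_0(\delta,\tau)$. Then, with probability at least $1-2\delta-2\exp(-n\epsilon^2/2)$, every minimiser $\hat h_{n,\Psi}$ over $h\in\mathscr H$ of $\frac1n\sum_{i=1}^n(h(X_i)-Y_i)^2+\lambda\Psi(h)$ satisfies both $$\Psi(\hat h_{n,\Psi})-\Psi(f^\star)\le\rho\qquad\text{and}\qquad \lVert\hat h_{n,\Psi}-f^\star\rVert_{L_2(\mu)}\le\max\Big\{r(\rho),\Big[\tfrac{32}{\kappa^2\epsilon}\lambda\Psi(f^\star)\Big]^{1/2}\Big\}.$$ -/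

import Mathlib

open MeasureTheory ProbabilityTheory
open scoped ENNReal

noncomputable section

namespace PISL

/-- The data of a physics-informed regression problem.  `law` is the joint law of `(X, Y)`; its first
marginal is the distribution of `X`.  `V` is the vector space of (genuine, everywhere defined)
functions on which the linear operator `D` acts, e.g. a Sobolev space, and the physical knowledge is
the linear equation `D u = g` in `L²` of the distribution of `X`. -/
structure Model (𝓧 : Type*) [MeasurableSpace 𝓧] where
  law : Measure (𝓧 × ℝ)
  isProb : IsProbabilityMeasure law
  memLp_response : MemLp (fun z : 𝓧 × ℝ => z.2) 2 law
  V : Submodule ℝ (𝓧 → ℝ)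
  measurable_of_mem : ∀ f ∈ V, Measurable f
  memLp_of_mem : ∀ f ∈ V, MemLp f 2 law.fst
  D : V →ₗ[ℝ] Lp ℝ 2 law.fst
  g : Lp ℝ 2 law.fst

attribute [instance] Model.isProb

namespace Model

variable {𝓧 : Type*} [MeasurableSpace 𝓧] (M : Model 𝓧)

/-- The distribution of `X`. -/
abbrev μ : Measure 𝓧 := M.law.fst

/-- The class in `L²(μ)` of a function of `V`. -/
def toL2 (f : M.V) : Lp ℝ 2 M.μ :=
  (M.memLp_of_mem (f : 𝓧 → ℝ) f.2).toLp (f : 𝓧 → ℝ)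

/-- The penalty `Ψ(f) = ‖D f - g‖` in `L²(μ)`. -/
def Psi (f : M.V) : ℝ := ‖M.D f - M.g‖

/-- The closed convex hull in `L²(μ)` of a class of functions. -/
def hull (H : Set M.V) : Set (Lp ℝ 2 M.μ) :=
  closure (convexHull ℝ (M.toL2 '' H))

/-- The small-ball assumption with constants `κ` and `ε`, for a class in `L²(μ)`. -/
def SmallBall (F : Set (Lp ℝ 2 M.μ)) (κ ε : ℝ) : Prop :=
  ∀ f ∈ F, ∀ h ∈ F, ENNReal.ofReal ε ≤ M.μ {x | κ * ‖f - h‖ ≤ |f x - h x|}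

/-- The mean squared error `E (f(X) - Y)²`. -/
def risk (f : Lp ℝ 2 M.μ) : ℝ := ∫ z, (f z.1 - z.2) ^ 2 ∂M.law

/-- `fstar` is (a version of) the minimiser of the mean squared error over the closed convex hull
of `H`, that is, of the `L²`-projection of `Y`. -/
def IsTarget (H : Set M.V) (fstar : M.V) : Prop :=
  M.toL2 fstar ∈ M.hull H ∧ ∀ f ∈ M.hull H, M.risk (M.toL2 fstar) ≤ M.risk f

/-- The noise `ξ = f*(X) - Y`. -/
def noise (fstar : M.V) (z : 𝓧 × ℝ) : ℝ := (fstar : 𝓧 → ℝ) z.1 - z.2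

/-- The law of a sample of size `n`. -/
def sampleLaw (n : ℕ) : Measure (Fin n → 𝓧 × ℝ) := Measure.pi fun _ => M.law

/-- The joint law of `n` independent random signs and of an independent sample of size `n`.  The
vector of signs is coded by a uniformly distributed vector of booleans. -/
def signSampleLaw (n : ℕ) : Measure ((Fin n → Bool) × (Fin n → 𝓧 × ℝ)) :=
  (PMF.uniformOfFintype (Fin n → Bool)).toMeasure.prod (M.sampleLaw n)

/-- The sign coded by a boolean. -/
def _root_.PISL.sign (b : Bool) : ℝ := if b then 1 else -1

/-- `G ∩ r D_{f*}`: the members of `G` at `L²(μ)`-distance at most `r` from `f*`. -/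
def localClass (G : Set M.V) (fstar : M.V) (r : ℝ≥0∞) : Set M.V :=
  {f | f ∈ G ∧ ‖M.toL2 f - M.toL2 fstar‖ₑ ≤ r}

/-- The supremum over `G ∩ r D_{f*}` of `|n⁻¹ ∑ εᵢ (f - f*)(Xᵢ)|`. -/
def radSup (n : ℕ) (G : Set M.V) (fstar : M.V) (r : ℝ≥0∞)
    (p : (Fin n → Bool) × (Fin n → 𝓧 × ℝ)) : ℝ≥0∞ :=
  ⨆ f ∈ M.localClass G fstar r,
    ‖(n : ℝ)⁻¹ * ∑ i, sign (p.1 i) *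
      ((f : 𝓧 → ℝ) (p.2 i).1 - (fstar : 𝓧 → ℝ) (p.2 i).1)‖ₑ

/-- The complexity `r_Q(G, τ)` (the infimum of the empty set is `∞`). -/
def rQ (n : ℕ) (G : Set M.V) (fstar : M.V) (τ : ℝ) : ℝ≥0∞ :=
  sInf (ENNReal.ofReal '' {r : ℝ | 0 < r ∧
    ∫⁻ p, M.radSup n G fstar (ENNReal.ofReal r) p ∂M.signSampleLaw n ≤ ENNReal.ofReal (τ * r)})

/-- The process `φ_n(G, f*, s)`: the supremum over `G ∩ s D_{f*}` of
`|n^{-1/2} ∑ εᵢ ξᵢ (f - f*)(Xᵢ)|`. -/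
def phi (n : ℕ) (G : Set M.V) (fstar : M.V) (s : ℝ≥0∞)
    (p : (Fin n → Bool) × (Fin n → 𝓧 × ℝ)) : ℝ≥0∞ :=
  ⨆ f ∈ M.localClass G fstar s,
    ‖(√(n : ℝ))⁻¹ * ∑ i, sign (p.1 i) * M.noise fstar (p.2 i) *
      ((f : 𝓧 → ℝ) (p.2 i).1 - (fstar : 𝓧 → ℝ) (p.2 i).1)‖ₑ

/-- The complexity `r_M(G, τ, δ)`. -/
def rM (n : ℕ) (G : Set M.V) (fstar : M.V) (τ δ : ℝ) : ℝ≥0∞ :=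
  sInf (ENNReal.ofReal '' {s : ℝ | 0 < s ∧
    ENNReal.ofReal (1 - δ) ≤ M.signSampleLaw n
      {p | M.phi n G fstar (ENNReal.ofReal s) p ≤ ENNReal.ofReal (τ * s ^ 2 * √(n : ℝ))}})

/-- `F(ρ, Ψ)`: the functions of the closed convex hull of `H` (on which `D` is defined) whose
penalty exceeds that of `f*` by at most `ρ`. -/
def penaltyClass (H : Set M.V) (fstar : M.V) (ρ : ℝ) : Set M.V :=
  {f | M.toL2 f ∈ M.hull H ∧ M.Psi f - M.Psi fstar ≤ ρ}

/-- `O(ρ)`: the supremum of the multiplier process `|P_n M_{f - f*}|` over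
`F(ρ, Ψ) ∩ r(ρ) D_{f*}`. -/
def multSup (n : ℕ) (H : Set M.V) (fstar : M.V) (r : ℝ → ℝ≥0∞) (ρ : ℝ)
    (S : Fin n → 𝓧 × ℝ) : ℝ≥0∞ :=
  ⨆ f ∈ M.localClass (M.penaltyClass H fstar ρ) fstar (r ρ),
    ‖(n : ℝ)⁻¹ * ∑ i, M.noise fstar (S i) *
        ((f : 𝓧 → ℝ) (S i).1 - (fstar : 𝓧 → ℝ) (S i).1)
      - ∫ z, M.noise fstar z * ((f : 𝓧 → ℝ) z.1 - (fstar : 𝓧 → ℝ) z.1) ∂M.law‖ₑ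

/-- `γ_O(ρ, τ, δ)`. -/
def gammaO (n : ℕ) (H : Set M.V) (fstar : M.V) (r : ℝ → ℝ≥0∞) (ρ τ δ : ℝ) : ℝ≥0∞ :=
  sInf (ENNReal.ofReal '' {z : ℝ | 0 < z ∧
    ENNReal.ofReal (1 - δ) ≤
      M.sampleLaw n {S | M.multSup n H fstar r ρ S ≤ ENNReal.ofReal (τ * z)}})

/-- `λ₀(δ, τ)`, for the target `f*` of the problem. -/
def lambda0 (n : ℕ) (H : Set M.V) (fstar : M.V) (r : ℝ → ℝ≥0∞) (δ τ : ℝ) : ℝ≥0∞ :=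
  ⨆ ρ : {ρ : ℝ // 0 < ρ}, M.gammaO n H fstar r ρ τ δ / ENNReal.ofReal ρ

/-- The physics-informed empirical error `n⁻¹ ∑ (h(Xᵢ) - Yᵢ)² + λ Ψ(h)`. -/
def informedLoss (n : ℕ) (lam : ℝ) (S : Fin n → 𝓧 × ℝ) (h : M.V) : ℝ :=
  (n : ℝ)⁻¹ * ∑ i, ((h : 𝓧 → ℝ) (S i).1 - (S i).2) ^ 2 + lam * M.Psi h

/-- `h` is a physics-informed estimator computed from the sample `S`. -/
def IsInformedEstimator (n : ℕ) (H : Set M.V) (lam : ℝ) (S : Fin n → 𝓧 × ℝ) (h : M.V) : Prop :=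
  h ∈ H ∧ ∀ h' ∈ H, M.informedLoss n lam S h ≤ M.informedLoss n lam S h'

/-- The standing convention that suprema over the class are measurable: for every number `m` of
observations, the supremum over the functions `f` of the closed convex hull of `H` of a nonnegative
functional of the observations and of `(f(x₁), …, f(x_m), f, D f)`, measurable in the former and
continuous in the latter, is a measurable function of the observations.  (It holds, for instance,
when some countable subclass approximates every `f` pointwise, in `L²(μ)`, and with its image
under `D`.) -/
def MeasurableSuprema (H : Set M.V) : Prop :=
  ∀ (m : ℕ) (Φ : (Fin m → 𝓧 × ℝ) → (Fin m → ℝ) × Lp ℝ 2 M.μ × Lp ℝ 2 M.μ → ℝ),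
    (∀ v, Measurable fun S => Φ S v) → (∀ S, Continuous (Φ S)) →
    Measurable fun S : Fin m → 𝓧 × ℝ =>
      ⨆ f ∈ {f : M.V | M.toL2 f ∈ M.hull H},
        ENNReal.ofReal (Φ S (fun i => (f : 𝓧 → ℝ) (S i).1, M.toL2 f, M.D f))

end Model

end PISL

end

/-! Put `d = ‖ĥ - f*‖`, `Q = n⁻¹ ∑ (ĥ - f*)(Xᵢ)²` and `L = n⁻¹ ∑ ξᵢ (ĥ - f*)(Xᵢ)`. Since `f*`
competes in `H`, minimality of `ĥ` gives the basic inequality `Q + 2L + λ(Ψ(ĥ) - Ψ(f*)) ≤ 0`. It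
remains to bound `L` and `Q` from below.

Multiplier part (`exists_multiplier_event`). Since `λ₀` is a supremum over all `ρ > 0`, arbitrarily
small penalty scales may be used. The class is convex, `Ψ` is convex and the multiplier process is
linear in `f - f*`, so a bound at scale `ρ` extends to every `f` that can be shrunk towards `f*`
into the localized class. If `r(ρ)/ρ` is unbounded as `ρ → 0`, every `f` is eventually reached along
a sequence of scales, and with the optimality condition `E ξ(f - f*) ≥ 0` this gives `L ≥ -τλψ` for
every `ψ > (Ψ(f) - Ψ(f*))₊`. Otherwise `r_M ≤ Cρ` near zero; there the defining bound on the sign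
process is quadratic in the radius while the process is linear, so the process vanishes identically
with large probability. A nonzero Rademacher sum vanishes with probability at most 1/2, hence all
products `ξᵢ (f - f*)(Xᵢ)` vanish, again with large probability, and `L = 0`.

As `2τ < 1`, the basic inequality then forces `Ψ(ĥ) ≤ Ψ(f*)`; letting `ψ → 0` gives `L ≥ 0`, whence
`Q ≤ λΨ(f*)`.

Quadratic part (`SmallBall.exists_quadratic_event`). The small-ball method, with a Lipschitz
threshold in place of an indicator, symmetrization, contraction and McDiarmid's inequality, yields
`Q ≥ (κ²ε/16) d²` as soon as `d > r(ρ)`. The two bounds on `Q` give the estimate of `d`.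

Bounds available only along a sequence of scales or radii are combined on the event that infinitely
many of them hold; by reverse Fatou this costs no probability. -/

/-! ### Limsup events. -/

/-- Reverse Fatou lemma for sets. -/
theorem le_measure_frequently {α : Type*} [MeasurableSpace α] {μ : Measure α} [IsFiniteMeasure μ]
    {E : ℕ → Set α} (hE : ∀ k, MeasurableSet (E k)) {c : ℝ≥0∞} (hc : ∀ k, c ≤ μ (E k)) :
    c ≤ μ {x | ∃ᶠ k in Filter.atTop, x ∈ E k} := by
  have h : {x | ∃ᶠ k in Filter.atTop, x ∈ E k} = ⋂ m, ⋃ k, E (m + k) := by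
    ext x
    simp only [Set.mem_ofPred_eq, Filter.frequently_atTop, Set.mem_iInter, Set.mem_iUnion]
    refine forall_congr' fun m => ⟨?_, ?_⟩
    · rintro ⟨b, hb, hx⟩
      exact ⟨b - m, by rwa [Nat.add_sub_cancel' hb]⟩
    · rintro ⟨k, hx⟩
      exact ⟨m + k, by omega, hx⟩
  have ht := tendsto_measure_iInter_atTop (μ := μ) (s := fun m => ⋃ k, E (m + k))
    (fun m => (MeasurableSet.iUnion fun k => hE _).nullMeasurableSet)
    (by
      intro a b hab x hx
      simp only [Set.mem_iUnion] at hx ⊢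
      obtain ⟨k, hk⟩ := hx
      exact ⟨b - a + k, by rwa [← add_assoc, Nat.add_sub_cancel' hab]⟩)
    ⟨0, measure_ne_top _ _⟩
  rw [h]
  exact ge_of_tendsto' ht fun m => (hc m).trans (measure_mono fun x hx =>
    Set.mem_iUnion.2 ⟨0, hx⟩)

theorem measurableSet_frequently {α : Type*} [MeasurableSpace α]
    {E : ℕ → Set α} (hE : ∀ k, MeasurableSet (E k)) :
    MeasurableSet {x | ∃ᶠ k in Filter.atTop, x ∈ E k} := by
  have h : {x | ∃ᶠ k in Filter.atTop, x ∈ E k} = ⋂ m, ⋃ k, ⋃ _ : m ≤ k, E k := by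
    ext x
    simp [Filter.frequently_atTop]
  rw [h]
  exact MeasurableSet.iInter fun m => MeasurableSet.iUnion fun k => MeasurableSet.iUnion fun _ => hE k

/-! ### McDiarmid's inequality. -/

/-- The moment generating function bound behind McDiarmid's bounded differences inequality. -/
theorem integral_exp_le_of_bounded_differences {α : Type*} [MeasurableSpace α] (ν : Measure α)
    [IsProbabilityMeasure ν] (c t : ℝ) (n : ℕ) (f : (Fin n → α) → ℝ)
    (hf : Measurable f) (B : ℝ) (hB : ∀ S, |f S| ≤ B)
    (hd : ∀ S i x, f (Function.update S i x) - f S ≤ c) :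
    ∫ S, Real.exp (t * (f S - ∫ S', f S' ∂Measure.pi fun _ => ν)) ∂(Measure.pi fun _ => ν)
      ≤ Real.exp (n * (c / 2) ^ 2 * t ^ 2 / 2) := by
  -- Condition on the first coordinate: the conditional mean `h` oscillates by at most `c`, so
  -- Hoeffding's lemma bounds its exponential moment, and the induction hypothesis handles each
  -- fibre. The exponents add up.
  induction n with
  | zero =>
    have h0 : ∀ S : Fin 0 → α, f S = f default := fun S => congrArg f (Subsingleton.elim _ _)
    simp only [h0]
    simp
  | succ n ih =>
    set m := ∫ S', f S' ∂Measure.pi fun _ => ν with hm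
    have hne : Nonempty α := nonempty_of_isProbabilityMeasure ν
    let e := MeasurableEquiv.piFinSuccAbove (fun _ : Fin (n + 1) => α) 0
    have he : MeasurePreserving e.symm (ν.prod (Measure.pi fun _ => ν)) (Measure.pi fun _ => ν) :=
      (measurePreserving_piFinSuccAbove (fun _ : Fin (n + 1) => ν) 0).symm _
    let F : α → (Fin n → α) → ℝ := fun x y => f (e.symm (x, y))
    have hF : ∀ x y, F x y = f (Fin.cons x y) := by
      intro x y
      simp only [F, e]
      congr 1
      exact Fin.insertNth_zero' x y
    have hFm : Measurable (fun p : α × (Fin n → α) => F p.1 p.2) := hf.comp e.symm.measurable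
    have hFx : ∀ x, Measurable (F x) := fun x => hFm.comp measurable_prodMk_left
    have hFB : ∀ x y, |F x y| ≤ B := fun x y => hB _
    have hFi : ∀ x, Integrable (F x) (Measure.pi fun _ => ν) := fun x =>
      Integrable.of_bound (hFx x).aestronglyMeasurable B (Filter.Eventually.of_forall (hFB x))
    let h : α → ℝ := fun x => ∫ y, F x y ∂Measure.pi fun _ => ν
    have hhm : Measurable h := hFm.stronglyMeasurable.integral_prod_right.measurable
    have hhd : ∀ x x', h x - h x' ≤ c := by
      intro x x'
      simp only [h]
      rw [← integral_sub (hFi x) (hFi x')]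
      have h1 : ∀ y, F x y - F x' y ≤ c := by
        intro y
        have h2 := hd (Fin.cons x' y) 0 x
        rw [Fin.update_cons_zero] at h2
        rw [hF, hF]
        exact h2
      calc _ ≤ ∫ y, c ∂(Measure.pi fun _ : Fin n => ν) :=
            integral_mono ((hFi x).sub (hFi x')) (integrable_const c) h1
        _ = c := by simp
    have hhB : ∀ x, |h x| ≤ B := by
      intro x
      have := norm_integral_le_of_norm_le_const (μ := Measure.pi fun _ : Fin n => ν)
        (f := F x) (C := B) (Filter.Eventually.of_forall (hFB x))
      simpa using this
    have hbdd : BddBelow (Set.range h) := ⟨-B, by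
      rintro _ ⟨x, rfl⟩; exact (abs_le.1 (hhB x)).1⟩
    have hIcc : ∀ x, h x ∈ Set.Icc (⨅ x', h x') ((⨅ x', h x') + c) := fun x =>
      ⟨ciInf_le hbdd x, by
        have : h x - c ≤ ⨅ x', h x' := le_ciInf fun x' => by linarith [hhd x x']
        linarith⟩
    have hmh : m = ∫ x, h x ∂ν := by
      rw [hm, ← he.integral_comp', integral_prod]
      exact Integrable.of_bound hFm.aestronglyMeasurable B
        (Filter.Eventually.of_forall fun p => hFB _ _)
    have hoeff : ∫ x, Real.exp (t * (h x - m)) ∂ν ≤ Real.exp ((c / 2) ^ 2 * t ^ 2 / 2) := by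
      have h1 := (hasSubgaussianMGF_of_mem_Icc (μ := ν) hhm.aemeasurable
        (Filter.Eventually.of_forall hIcc)).mgf_le t
      rw [← hmh] at h1
      simpa [mgf, sq_abs, div_pow] using h1
    have hinner : ∀ x, ∫ y, Real.exp (t * (F x y - h x)) ∂(Measure.pi fun _ => ν)
        ≤ Real.exp (n * (c / 2) ^ 2 * t ^ 2 / 2) := by
      intro x
      refine ih (F x) (hFx x) (hFB x) ?_
      intro S i z
      have := hd (Fin.cons x S) i.succ z
      rw [← Fin.cons_update] at this
      rw [hF, hF]
      exact this
    have hexpB : ∀ a : ℝ, |a| ≤ 2 * B → Real.exp (t * a) ≤ Real.exp (|t| * (2 * B)) := by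
      intro a ha
      refine Real.exp_le_exp.2 ((le_abs_self _).trans ?_)
      rw [abs_mul]
      exact mul_le_mul_of_nonneg_left ha (abs_nonneg _)
    have hmB : |m| ≤ B := by
      have := norm_integral_le_of_norm_le_const (μ := Measure.pi fun _ : Fin (n + 1) => ν)
        (f := f) (C := B) (Filter.Eventually.of_forall hB)
      simpa using this
    have habs : ∀ a b : ℝ, |a| ≤ B → |b| ≤ B → |a - b| ≤ 2 * B := fun a b ha hb =>
      (abs_sub a b).trans (by linarith)
    have hint1 : Integrable (fun p : α × (Fin n → α) => Real.exp (t * (F p.1 p.2 - m)))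
        (ν.prod (Measure.pi fun _ => ν)) :=
      Integrable.of_bound (by fun_prop) (Real.exp (|t| * (2 * B)))
        (Filter.Eventually.of_forall fun p => by
          rw [Real.norm_eq_abs, Real.abs_exp]
          exact hexpB _ (habs _ _ (hFB _ _) hmB))
    have hint2 : Integrable (fun x => Real.exp (t * (h x - m))) ν :=
      Integrable.of_bound (by fun_prop) (Real.exp (|t| * (2 * B)))
        (Filter.Eventually.of_forall fun p => by
          rw [Real.norm_eq_abs, Real.abs_exp]
          exact hexpB _ (habs _ _ (hhB _) hmB))
    calc ∫ S, Real.exp (t * (f S - m)) ∂(Measure.pi fun _ => ν)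
        = ∫ p, Real.exp (t * (F p.1 p.2 - m)) ∂(ν.prod (Measure.pi fun _ => ν)) :=
          (he.integral_comp' _).symm
      _ = ∫ x, ∫ y, Real.exp (t * (F x y - m)) ∂(Measure.pi fun _ => ν) ∂ν :=
          integral_prod _ hint1
      _ ≤ ∫ x, Real.exp (t * (h x - m)) * Real.exp (n * (c / 2) ^ 2 * t ^ 2 / 2) ∂ν := by
          refine integral_mono hint1.integral_prod_left (hint2.mul_const _) fun x => ?_
          have h1 : ∀ y, Real.exp (t * (F x y - m))
              = Real.exp (t * (h x - m)) * Real.exp (t * (F x y - h x)) := by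
            intro y
            rw [← Real.exp_add]
            congr 1
            ring
          simp only [h1]
          rw [integral_const_mul]
          exact mul_le_mul_of_nonneg_left (hinner x) (Real.exp_pos _).le
      _ = (∫ x, Real.exp (t * (h x - m)) ∂ν) * Real.exp (n * (c / 2) ^ 2 * t ^ 2 / 2) :=
          integral_mul_const _ _
      _ ≤ Real.exp ((c / 2) ^ 2 * t ^ 2 / 2) * Real.exp (n * (c / 2) ^ 2 * t ^ 2 / 2) :=
          mul_le_mul_of_nonneg_right hoeff (Real.exp_pos _).le
      _ = _ := by
          rw [← Real.exp_add]
          congr 1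
          push_cast
          ring

/-- **McDiarmid's inequality** for a function with differences bounded by `1 / n`. -/
theorem measure_ge_le_of_bounded_differences {α : Type*} [MeasurableSpace α] (ν : Measure α)
    [IsProbabilityMeasure ν] {n : ℕ} (hn : 0 < n) {x : ℝ} (f : (Fin n → α) → ℝ)
    (hf : Measurable f) (B : ℝ) (hB : ∀ S, |f S| ≤ B) (hx : 0 ≤ x)
    (hd : ∀ S i z, f (Function.update S i z) - f S ≤ (n : ℝ)⁻¹) :
    (Measure.pi fun _ => ν).real {S | x ≤ f S - ∫ S', f S' ∂Measure.pi fun _ => ν}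
      ≤ Real.exp (-(2 * n * x ^ 2)) := by
  set m := ∫ S', f S' ∂Measure.pi fun _ => ν with hm
  have hn' : (0 : ℝ) < n := by exact_mod_cast hn
  have hmB : |m| ≤ B := by
    have := norm_integral_le_of_norm_le_const (μ := Measure.pi fun _ : Fin n => ν)
      (f := f) (C := B) (Filter.Eventually.of_forall hB)
    simpa using this
  -- The exponential moment bound is `exp (t² / (8n))`; `t = 4nx` minimises `-tx + t² / (8n)`, with
  -- minimum `-2nx²`.
  have hint : Integrable (fun S => Real.exp (4 * n * x * (f S - m))) (Measure.pi fun _ => ν) := by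
    refine Integrable.of_bound (by fun_prop) (Real.exp (4 * n * x * (2 * B)))
      (Filter.Eventually.of_forall fun S => ?_)
    rw [Real.norm_eq_abs, Real.abs_exp]
    refine Real.exp_le_exp.2 (mul_le_mul_of_nonneg_left ?_ (by positivity))
    linarith [(abs_le.1 (hB S)).2, (abs_le.1 hmB).1]
  have h1 := measure_ge_le_exp_mul_mgf (μ := Measure.pi fun _ => ν) (X := fun S => f S - m)
    x (t := 4 * n * x) (by positivity) hint
  refine h1.trans ?_
  have h2 := integral_exp_le_of_bounded_differences ν (n : ℝ)⁻¹ (4 * n * x) n f hf B hB hd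
  rw [← hm] at h2
  calc _ ≤ Real.exp (-(4 * n * x) * x)
        * Real.exp (n * ((n : ℝ)⁻¹ / 2) ^ 2 * (4 * n * x) ^ 2 / 2) :=
        mul_le_mul_of_nonneg_left h2 (Real.exp_pos _).le
    _ = _ := by
        rw [← Real.exp_add]
        congr 1
        field_simp
        ring

/-! ### Contraction for Rademacher sums. -/

namespace PISL

theorem sign_not (b : Bool) : sign (!b) = -sign b := by cases b <;> simp [sign]

theorem abs_sign (b : Bool) : |sign b| = 1 := by cases b <;> simp [sign]

/-- At maximisers `s`, `t` of the two left-hand suprema, `p s - p t ≤ |q s - q t|`. The sign of `q s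
- q t` decides which of `s`, `t` to insert into which supremum on the right. -/
theorem sup'_add_sup'_le {ι : Type*} (T : Finset ι) (hT : T.Nonempty) (g p q : ι → ℝ)
    (h : ∀ s t, |p s - p t| ≤ |q s - q t|) :
    T.sup' hT (fun t => g t + p t) + T.sup' hT (fun t => g t - p t)
      ≤ T.sup' hT (fun t => g t + q t) + T.sup' hT (fun t => g t - q t) := by
  obtain ⟨s, hs, es⟩ := T.exists_mem_eq_sup' hT (fun t => g t + p t)
  obtain ⟨t, ht, et⟩ := T.exists_mem_eq_sup' hT (fun t => g t - p t)
  rw [es, et]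
  have h1 := T.le_sup' (fun t => g t + q t) hs
  have h2 := T.le_sup' (fun t => g t + q t) ht
  have h3 := T.le_sup' (fun t => g t - q t) hs
  have h4 := T.le_sup' (fun t => g t - q t) ht
  have h5 := (le_abs_self _).trans (h s t)
  rcases abs_cases (q s - q t) with ⟨e, _⟩ | ⟨e, _⟩ <;> linarith

/-- Flipping the `i`-th boolean. -/
def flipAt {n : ℕ} (i : Fin n) : Equiv.Perm (Fin n → Bool) where
  toFun σ := Function.update σ i (!σ i)
  invFun σ := Function.update σ i (!σ i)
  left_inv σ := by simp
  right_inv σ := by simp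

theorem flipAt_same {n : ℕ} (i : Fin n) (σ : Fin n → Bool) : flipAt i σ i = !σ i := by
  simp [flipAt]

theorem flipAt_ne {n : ℕ} {i j : Fin n} (h : j ≠ i) (σ : Fin n → Bool) :
    flipAt i σ j = σ j := by
  simp [flipAt, h]

theorem sum_sign_eq {n : ℕ} (i : Fin n) (σ : Fin n → Bool) (c : Fin n → ℝ) :
    ∑ j, sign (σ j) * c j = ∑ j ∈ Finset.univ.erase i, sign (σ j) * c j + sign (σ i) * c i :=
  (Finset.sum_erase_add _ _ (Finset.mem_univ i)).symm

theorem sum_sign_flipAt {n : ℕ} (i : Fin n) (σ : Fin n → Bool) (c : Fin n → ℝ) :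
    ∑ j, sign (flipAt i σ j) * c j
      = ∑ j ∈ Finset.univ.erase i, sign (σ j) * c j - sign (σ i) * c i := by
  rw [sum_sign_eq i, flipAt_same, sign_not, neg_mul, ← sub_eq_add_neg]
  congr 1
  exact Finset.sum_congr rfl fun j hj => by rw [flipAt_ne (Finset.ne_of_mem_erase hj)]

/-- One step of the contraction principle: pairing each sign vector with its flip at `i` isolates
the dependence on coordinate `i`, where `sup'_add_sup'_le` applies. -/
theorem sum_sup'_sign_le_of_eq_off {ι : Type*} {n : ℕ} (T : Finset ι) (hT : T.Nonempty)
    (c c' : ι → Fin n → ℝ) (i : Fin n) (hoff : ∀ t j, j ≠ i → c t j = c' t j)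
    (h : ∀ s t, |c s i - c t i| ≤ |c' s i - c' t i|) :
    ∑ σ : Fin n → Bool, T.sup' hT (fun t => ∑ j, sign (σ j) * c t j)
      ≤ ∑ σ : Fin n → Bool, T.sup' hT (fun t => ∑ j, sign (σ j) * c' t j) := by
  have key : ∀ F : (Fin n → Bool) → ℝ, 2 * ∑ σ, F σ = ∑ σ, (F σ + F (flipAt i σ)) := by
    intro F
    rw [Finset.sum_add_distrib, Equiv.sum_comp (flipAt i) F, two_mul]
  refine le_of_mul_le_mul_left ?_ (zero_lt_two' ℝ)
  rw [key, key]
  refine Finset.sum_le_sum fun σ _ => ?_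
  simp only [sum_sign_flipAt]
  simp only [sum_sign_eq i σ]
  have e : ∀ t, ∑ j ∈ Finset.univ.erase i, sign (σ j) * c t j
      = ∑ j ∈ Finset.univ.erase i, sign (σ j) * c' t j := fun t =>
    Finset.sum_congr rfl fun j hj => by rw [hoff t j (Finset.ne_of_mem_erase hj)]
  simp only [e]
  refine sup'_add_sup'_le T hT _ _ _ fun s t => ?_
  rw [← mul_sub, ← mul_sub, abs_mul, abs_mul, abs_sign, one_mul, one_mul]
  exact h s t

/-- The contraction principle for Rademacher sums, over a finite class. -/
theorem sum_sup'_sign_le {ι : Type*} {n : ℕ} (T : Finset ι) (hT : T.Nonempty)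
    (p q : ι → Fin n → ℝ) (h : ∀ j s t, |p s j - p t j| ≤ |q s j - q t j|) :
    ∑ σ : Fin n → Bool, T.sup' hT (fun t => ∑ j, sign (σ j) * p t j)
      ≤ ∑ σ : Fin n → Bool, T.sup' hT (fun t => ∑ j, sign (σ j) * q t j) := by
  -- Hybrid argument: `p` is replaced by `q` one coordinate at a time, `J` being the set already
  -- replaced.
  have key : ∀ J : Finset (Fin n),
      ∑ σ : Fin n → Bool, T.sup' hT (fun t => ∑ j, sign (σ j) * p t j)
      ≤ ∑ σ : Fin n → Bool,
        T.sup' hT (fun t => ∑ j, sign (σ j) * (if j ∈ J then q t j else p t j)) := by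
    intro J
    induction J using Finset.induction_on with
    | empty => simp
    | insert i J hi ih =>
      refine ih.trans (sum_sup'_sign_le_of_eq_off T hT _ _ i ?_ ?_)
      · intro t j hj
        simp [hj]
      · intro s t
        simpa [hi] using h i s t
  simpa using key Finset.univ

/-- The contraction principle for Rademacher sums. -/
theorem sum_iSup_sign_le {ι : Type*} {n : ℕ} (p q : ι → Fin n → ℝ) (s₀ : ι)
    (hp : ∀ j, p s₀ j = 0) (hq : ∀ j, q s₀ j = 0)
    (h : ∀ j s t, |p s j - p t j| ≤ |q s j - q t j|) :
    ∑ σ : Fin n → Bool, ⨆ s, ENNReal.ofReal (∑ j, sign (σ j) * p s j)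
      ≤ ∑ σ : Fin n → Bool, ⨆ s, ENNReal.ofReal (∑ j, sign (σ j) * q s j) := by
  classical
  have e : ∀ a : ι → ℝ≥0∞, ⨆ s, a s = ⨆ T : Finset ι, T.sup a := by
    intro a
    refine le_antisymm (iSup_le fun s => ?_) (iSup_le fun T => Finset.sup_le fun s _ => le_iSup a s)
    exact le_iSup_of_le {s} (by simp)
  simp only [e (fun s => ENNReal.ofReal (∑ j, sign (_ : Bool) * p s j))]
  rw [ENNReal.finsetSum_iSup_of_monotone (f := fun (σ : Fin n → Bool) (T : Finset ι) =>
    T.sup fun s => ENNReal.ofReal (∑ j, sign (σ j) * p s j))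
    (fun σ T T' hTT => Finset.sup_mono hTT)]
  refine iSup_le fun T => ?_
  -- Adjoining the zero element `s₀` makes every finite maximum nonnegative, so that
  -- `ENNReal.ofReal` commutes with the sum over signs.
  have hT : (insert s₀ T).Nonempty := Finset.insert_nonempty _ _
  have hnn : ∀ (c : ι → Fin n → ℝ) (σ : Fin n → Bool), (∀ j, c s₀ j = 0) →
      0 ≤ (insert s₀ T).sup' hT (fun t => ∑ j, sign (σ j) * c t j) := by
    intro c σ hc
    refine le_trans ?_ (Finset.le_sup' _ (Finset.mem_insert_self s₀ T))
    simp [hc]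
  calc ∑ σ : Fin n → Bool, T.sup (fun s => ENNReal.ofReal (∑ j, sign (σ j) * p s j))
      ≤ ∑ σ : Fin n → Bool, ENNReal.ofReal
          ((insert s₀ T).sup' hT (fun t => ∑ j, sign (σ j) * p t j)) := by
        refine Finset.sum_le_sum fun σ _ => Finset.sup_le fun s hs => ?_
        exact ENNReal.ofReal_le_ofReal
          (Finset.le_sup' (fun t => ∑ j, sign (σ j) * p t j) (Finset.mem_insert_of_mem hs))
    _ = ENNReal.ofReal (∑ σ : Fin n → Bool,
          (insert s₀ T).sup' hT (fun t => ∑ j, sign (σ j) * p t j)) :=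
        (ENNReal.ofReal_sum_of_nonneg fun σ _ => hnn p σ hp).symm
    _ ≤ ENNReal.ofReal (∑ σ : Fin n → Bool,
          (insert s₀ T).sup' hT (fun t => ∑ j, sign (σ j) * q t j)) :=
        ENNReal.ofReal_le_ofReal (sum_sup'_sign_le _ hT p q h)
    _ = ∑ σ : Fin n → Bool, ENNReal.ofReal
          ((insert s₀ T).sup' hT (fun t => ∑ j, sign (σ j) * q t j)) :=
        ENNReal.ofReal_sum_of_nonneg fun σ _ => hnn q σ hq
    _ ≤ _ := by
        refine Finset.sum_le_sum fun σ _ => ?_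
        obtain ⟨s, _, es⟩ := (insert s₀ T).exists_mem_eq_sup' hT
          (fun t => ∑ j, sign (σ j) * q t j)
        rw [es]
        exact le_iSup (fun s => ENNReal.ofReal (∑ j, sign (σ j) * q s j)) s

theorem ofReal_integral_le_lintegral {α : Type*} [MeasurableSpace α] {μ : Measure α} (f : α → ℝ) :
    ENNReal.ofReal (∫ x, f x ∂μ) ≤ ∫⁻ x, ENNReal.ofReal (f x) ∂μ := by
  by_cases hf : Integrable f μ
  · refine ENNReal.ofReal_le_of_le_toReal ?_
    rw [integral_eq_lintegral_pos_part_sub_lintegral_neg_part hf]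
    exact sub_le_self _ ENNReal.toReal_nonneg
  · simp [integral_undef hf]

/-! ### Symmetrization. -/

section Symmetrization

variable {ι α : Type*} [MeasurableSpace α] (ν : Measure α) [IsProbabilityMeasure ν] {n : ℕ}

theorem measurePreserving_arrowProd :
    MeasurePreserving (fun z : Fin n → α × α => ((fun i => (z i).1, fun i => (z i).2) :
        (Fin n → α) × (Fin n → α)))
      (Measure.pi fun _ => ν.prod ν) ((Measure.pi fun _ => ν).prod (Measure.pi fun _ => ν)) :=
  measurePreserving_arrowProdEquivProdArrow α α (Fin n) (fun _ => ν) (fun _ => ν)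

/-- Symmetrization with a fixed vector of signs. -/
theorem lintegral_iSup_deviation_le (h : ι → α → ℝ) (hm : ∀ s, Measurable (h s)) (B : ℝ)
    (hB : ∀ s x, |h s x| ≤ B)
    (hsup : ∀ (m : ℕ) (a : Fin m → ℝ),
      Measurable fun S : Fin m → α => ⨆ s, ENNReal.ofReal (∑ i, a i * h s (S i)))
    (σ : Fin n → Bool) :
    ∫⁻ S, ⨆ s, ENNReal.ofReal (∑ i, (∫ x, h s x ∂ν - h s (S i))) ∂(Measure.pi fun _ : Fin n => ν)
      ≤ ∫⁻ S, ⨆ s, ENNReal.ofReal (∑ i, sign (σ i) * h s (S i)) ∂(Measure.pi fun _ : Fin n => ν)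
        + ∫⁻ S, ⨆ s, ENNReal.ofReal (∑ i, sign (!σ i) * h s (S i))
            ∂(Measure.pi fun _ : Fin n => ν) := by
  let W : (Fin n → α) × (Fin n → α) → ℝ≥0∞ := fun p =>
    ⨆ s, ENNReal.ofReal (∑ i, (h s (p.2 i) - h s (p.1 i)))
  let R : (Fin n → Bool) → (Fin n → α) → ℝ≥0∞ := fun σ S =>
    ⨆ s, ENNReal.ofReal (∑ i, sign (σ i) * h s (S i))
  have hR : ∀ σ, Measurable (R σ) := fun σ => hsup n _
  have hW : Measurable W := by
    -- Sample and ghost sample form one sample of size `2n`, which is why measurability is required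
    -- for every number of observations.
    have h1 := hsup (n + n) (Fin.append (fun _ => -1) (fun _ => 1))
    have h2 : Measurable fun p : (Fin n → α) × (Fin n → α) => Fin.append p.1 p.2 := by
      refine measurable_pi_lambda _ fun i => ?_
      refine Fin.addCases (fun j => ?_) (fun j => ?_) i
      · simp only [Fin.append_left]; fun_prop
      · simp only [Fin.append_right]; fun_prop
    convert h1.comp h2 using 1
    funext p
    simp only [W, Function.comp, Fin.sum_univ_add, Fin.append_left, Fin.append_right]
    refine iSup_congr fun s => ?_
    rw [Finset.sum_sub_distrib]
    simp only [neg_mul, one_mul, Finset.sum_neg_distrib]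
    congr 1
    ring
  have step1 : ∫⁻ S, ⨆ s, ENNReal.ofReal (∑ i, (∫ x, h s x ∂ν - h s (S i)))
      ∂(Measure.pi fun _ : Fin n => ν)
      ≤ ∫⁻ p, W p ∂((Measure.pi fun _ => ν).prod (Measure.pi fun _ => ν)) := by
    rw [lintegral_prod _ hW.aemeasurable]
    refine lintegral_mono fun S => iSup_le fun s => ?_
    have hi : ∀ i : Fin n, Integrable (fun S' : Fin n → α => h s (S' i) - h s (S i))
        (Measure.pi fun _ => ν) := fun i =>
      Integrable.of_bound (((hm s).comp (measurable_pi_apply i)).sub_const _).aestronglyMeasurable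
        (B + B) (Filter.Eventually.of_forall fun S' => by
          rw [Real.norm_eq_abs]
          exact (abs_sub _ _).trans (add_le_add (hB _ _) (hB _ _)))
    have e : ∑ i, (∫ x, h s x ∂ν - h s (S i))
        = ∫ S' : Fin n → α, ∑ i, (h s (S' i) - h s (S i)) ∂(Measure.pi fun _ => ν) := by
      rw [integral_finsetSum _ fun i _ => hi i]
      refine Finset.sum_congr rfl fun i _ => ?_
      have hii : Integrable (fun S' : Fin n → α => h s (S' i)) (Measure.pi fun _ => ν) :=
        Integrable.of_bound ((hm s).comp (measurable_pi_apply i)).aestronglyMeasurable B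
          (Filter.Eventually.of_forall fun S' => hB _ _)
      rw [integral_sub hii (integrable_const _), integral_comp_eval (hm s).aestronglyMeasurable]
      simp
    rw [e]
    refine (ofReal_integral_le_lintegral _).trans (lintegral_mono fun S' => ?_)
    exact le_iSup (fun s => ENNReal.ofReal (∑ i, (h s (S' i) - h s (S i)))) s
  refine step1.trans ?_
  -- Exchanging the pair at each `i` with `σ i = false` preserves the joint law and inserts the
  -- signs `σ` on the ghost sample and `-σ` on the original one.
  let sw : (Fin n → α × α) → (Fin n → α × α) := fun z i => if σ i then z i else (z i).swap
  have hsw : MeasurePreserving sw (Measure.pi fun _ => ν.prod ν) (Measure.pi fun _ => ν.prod ν) := by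
    refine measurePreserving_pi (f := fun i (a : α × α) => if σ i then a else a.swap) _ _ fun i => ?_
    cases σ i
    · simpa using Measure.measurePreserving_swap
    · exact MeasurePreserving.id _
  have hmp := measurePreserving_arrowProd ν (n := n)
  rw [← hmp.lintegral_comp hW, ← hsw.lintegral_comp (f := fun z => W (fun i => (z i).1, fun i => (z i).2))
    (hW.comp hmp.measurable)]
  have hle : ∀ z : Fin n → α × α, W ((fun i => (sw z i).1, fun i => (sw z i).2))
      ≤ R σ (fun i => (z i).2) + R (fun i => !σ i) (fun i => (z i).1) := by
    intro z
    refine iSup_le fun s => ?_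
    have e : ∑ i, (h s (sw z i).2 - h s (sw z i).1)
        = ∑ i, sign (σ i) * h s (z i).2 + ∑ i, sign (!σ i) * h s (z i).1 := by
      rw [← Finset.sum_add_distrib]
      refine Finset.sum_congr rfl fun i _ => ?_
      cases hσ : σ i <;> simp [sw, hσ, sign] <;> ring
    simp only
    rw [e]
    exact ENNReal.ofReal_add_le.trans (add_le_add
      (le_iSup (fun s => ENNReal.ofReal (∑ i, sign (σ i) * h s (z i).2)) s)
      (le_iSup (fun s => ENNReal.ofReal (∑ i, sign (!σ i) * h s (z i).1)) s))
  refine (lintegral_mono hle).trans ?_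
  have hR1 : Measurable fun z : Fin n → α × α => R σ (fun i => (z i).2) :=
    (hR σ).comp (by fun_prop)
  rw [lintegral_add_left hR1]
  have h2 := hmp.lintegral_comp ((hR σ).comp measurable_snd)
  have h3 := hmp.lintegral_comp ((hR fun i => !σ i).comp measurable_fst)
  have h4 := (measurePreserving_snd (μ := Measure.pi fun _ : Fin n => ν)
    (ν := Measure.pi fun _ : Fin n => ν)).lintegral_comp (hR σ)
  have h5 := (measurePreserving_fst (μ := Measure.pi fun _ : Fin n => ν)
    (ν := Measure.pi fun _ : Fin n => ν)).lintegral_comp (hR fun i => !σ i)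
  refine add_le_add (le_of_eq ?_) (le_of_eq ?_)
  · exact h2.trans h4
  · exact h3.trans h5

/-- Symmetrization. -/
theorem two_pow_mul_lintegral_iSup_deviation_le (h : ι → α → ℝ) (hm : ∀ s, Measurable (h s))
    (B : ℝ) (hB : ∀ s x, |h s x| ≤ B)
    (hsup : ∀ (m : ℕ) (a : Fin m → ℝ),
      Measurable fun S : Fin m → α => ⨆ s, ENNReal.ofReal (∑ i, a i * h s (S i))) :
    2 ^ n * ∫⁻ S, ⨆ s, ENNReal.ofReal (∑ i, (∫ x, h s x ∂ν - h s (S i)))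
        ∂(Measure.pi fun _ : Fin n => ν)
      ≤ 2 * ∫⁻ S, ∑ σ : Fin n → Bool, ⨆ s, ENNReal.ofReal (∑ i, sign (σ i) * h s (S i))
          ∂(Measure.pi fun _ : Fin n => ν) := by
  let Q : (Fin n → Bool) → ℝ≥0∞ := fun σ =>
    ∫⁻ S, ⨆ s, ENNReal.ofReal (∑ i, sign (σ i) * h s (S i)) ∂(Measure.pi fun _ : Fin n => ν)
  have h1 : ∑ _σ : Fin n → Bool, ∫⁻ S, ⨆ s, ENNReal.ofReal (∑ i, (∫ x, h s x ∂ν - h s (S i)))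
        ∂(Measure.pi fun _ : Fin n => ν) ≤ ∑ σ : Fin n → Bool, (Q σ + Q (fun i => !σ i)) :=
    Finset.sum_le_sum fun σ _ => lintegral_iSup_deviation_le ν h hm B hB hsup σ
  have h2 : ∑ σ : Fin n → Bool, Q (fun i => !σ i) = ∑ σ, Q σ := by
    refine Equiv.sum_comp (Function.Involutive.toPerm (fun (σ : Fin n → Bool) i => !σ i) ?_) Q
    intro σ
    simp
  rw [Finset.sum_add_distrib, h2, ← two_mul] at h1
  rw [lintegral_finsetSum _ fun σ _ => hsup n _]
  simpa using h1

end Symmetrization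

end PISL

/-! ### Segments to the target, measurable suprema, and optimality of the target. -/

noncomputable section

namespace PISL

namespace Model

variable {𝓧 : Type*} [MeasurableSpace 𝓧] (M : Model 𝓧)

theorem toL2_coe (f : M.V) : M.toL2 f =ᵐ[M.μ] (f : 𝓧 → ℝ) :=
  (M.memLp_of_mem (f : 𝓧 → ℝ) f.2).coeFn_toLp

/-- The point `f* + t (f - f*)`. -/
def seg (fstar f : M.V) (t : ℝ) : M.V := fstar + t • (f - fstar)

theorem seg_apply (fstar f : M.V) (t : ℝ) (x : 𝓧) :
    (M.seg fstar f t : 𝓧 → ℝ) x - (fstar : 𝓧 → ℝ) x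
      = t * ((f : 𝓧 → ℝ) x - (fstar : 𝓧 → ℝ) x) := by
  simp [seg]

theorem toL2_seg (fstar f : M.V) (t : ℝ) :
    M.toL2 (M.seg fstar f t) = M.toL2 fstar + t • (M.toL2 f - M.toL2 fstar) := rfl

theorem toL2_seg_sub (fstar f : M.V) (t : ℝ) :
    M.toL2 (M.seg fstar f t) - M.toL2 fstar = t • (M.toL2 f - M.toL2 fstar) := by
  rw [toL2_seg, add_sub_cancel_left]

theorem norm_toL2_seg_sub (fstar f : M.V) {t : ℝ} (ht : 0 ≤ t) :
    ‖M.toL2 (M.seg fstar f t) - M.toL2 fstar‖ = t * ‖M.toL2 f - M.toL2 fstar‖ := by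
  rw [toL2_seg_sub, norm_smul, Real.norm_of_nonneg ht]

theorem convex_hull (H : Set M.V) : Convex ℝ (M.hull H) :=
  (convex_convexHull ℝ _).closure

theorem seg_mem_hull {H : Set M.V} {fstar f : M.V} (hs : M.toL2 fstar ∈ M.hull H)
    (hf : M.toL2 f ∈ M.hull H) {t : ℝ} (h0 : 0 ≤ t) (h1 : t ≤ 1) :
    M.toL2 (M.seg fstar f t) ∈ M.hull H := by
  rw [toL2_seg]
  exact (M.convex_hull H).add_smul_sub_mem hs hf ⟨h0, h1⟩

theorem Psi_nonneg (f : M.V) : 0 ≤ M.Psi f := norm_nonneg _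

theorem Psi_seg_sub_le (fstar f : M.V) {t : ℝ} (h0 : 0 ≤ t) (h1 : t ≤ 1) :
    M.Psi (M.seg fstar f t) - M.Psi fstar ≤ t * (M.Psi f - M.Psi fstar) := by
  have e : M.D (M.seg fstar f t) - M.g = (1 - t) • (M.D fstar - M.g) + t • (M.D f - M.g) := by
    simp only [seg, map_add, map_smul, map_sub]
    module
  have h2 : M.Psi (M.seg fstar f t) ≤ (1 - t) * M.Psi fstar + t * M.Psi f := by
    rw [Psi, e]
    refine (norm_add_le _ _).trans ?_
    rw [norm_smul, norm_smul, Real.norm_of_nonneg h0, Real.norm_of_nonneg (sub_nonneg.2 h1)]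
    rfl
  linarith

/-- Suprema over the part of the class cut out by an open constraint are measurable. -/
theorem MeasurableSuprema.measurable_iSup {M : Model 𝓧} {H : Set M.V} (hmeas : M.MeasurableSuprema H) (m : ℕ)
    (Φ : (Fin m → 𝓧 × ℝ) → (Fin m → ℝ) × Lp ℝ 2 M.μ × Lp ℝ 2 M.μ → ℝ)
    (hΦm : ∀ v, Measurable fun S => Φ S v) (hΦc : ∀ S, Continuous (Φ S))
    (w : Lp ℝ 2 M.μ × Lp ℝ 2 M.μ → ℝ) (hw : Continuous w) :
    Measurable fun S : Fin m → 𝓧 × ℝ =>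
      ⨆ f : {f : M.V // M.toL2 f ∈ M.hull H ∧ 0 < w (M.toL2 f, M.D f)},
        ENNReal.ofReal (Φ S (fun i => (f.1 : 𝓧 → ℝ) (S i).1, M.toL2 f.1, M.D f.1)) := by
  -- Continuous cutoffs increasing to the indicator of `0 < w`; this is why the constraint must be
  -- open.
  let χ : ℕ → Lp ℝ 2 M.μ × Lp ℝ 2 M.μ → ℝ := fun k v => min 1 (k * max 0 (w v))
  have hχ0 : ∀ k v, 0 ≤ χ k v := fun k v => by positivity
  let Φ' : ℕ → (Fin m → 𝓧 × ℝ) → (Fin m → ℝ) × Lp ℝ 2 M.μ × Lp ℝ 2 M.μ → ℝ := fun k S v =>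
    max 0 (Φ S v) * χ k v.2
  have h1 : ∀ k, Measurable fun S : Fin m → 𝓧 × ℝ =>
      ⨆ f ∈ {f : M.V | M.toL2 f ∈ M.hull H},
        ENNReal.ofReal (Φ' k S (fun i => (f : 𝓧 → ℝ) (S i).1, M.toL2 f, M.D f)) := by
    intro k
    refine hmeas m (Φ' k) (fun v => ?_) (fun S => ?_)
    · exact (measurable_const.max (hΦm v)).mul_const _
    · have := hΦc S
      simp only [Φ', χ]
      fun_prop
  convert Measurable.iSup h1 using 1
  funext S
  refine le_antisymm (iSup_le fun f => ?_) (iSup_le fun k => iSup₂_le fun f hf => ?_)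
  · obtain ⟨f, hf, hw0⟩ := f
    obtain ⟨k, hk⟩ := exists_nat_ge (1 / w (M.toL2 f, M.D f))
    refine le_iSup_of_le k (le_iSup₂_of_le f hf (ENNReal.ofReal_le_ofReal ?_))
    have h2 : χ k (M.toL2 f, M.D f) = 1 := by
      refine min_eq_left ?_
      rw [max_eq_right hw0.le]
      exact (div_le_iff₀ hw0).1 hk
    simp only [Φ', h2, mul_one]
    exact le_max_right _ _
  · by_cases hw0 : 0 < w (M.toL2 f, M.D f)
    · refine le_iSup_of_le (⟨f, hf, hw0⟩ : {f : M.V // M.toL2 f ∈ M.hull H ∧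
        0 < w (M.toL2 f, M.D f)}) ?_
      refine (ENNReal.ofReal_le_ofReal
        (mul_le_of_le_one_right (le_max_left _ _) (min_le_left _ _))).trans (le_of_eq ?_)
      simp
    · have h2 : χ k (M.toL2 f, M.D f) = 0 := by
        simp [χ, max_eq_left (not_lt.1 hw0)]
      simp [Φ', h2]

/-- The expectation of `ξ a(X)`, as a function of `a` in `L²`. -/
def noiseMean (fstar : M.V) (a : Lp ℝ 2 M.μ) : ℝ := ∫ z, M.noise fstar z * a z.1 ∂M.law

theorem measurePreserving_fst_law : MeasurePreserving Prod.fst M.law M.μ :=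
  ⟨measurable_fst, rfl⟩

theorem measurable_noise (fstar : M.V) : Measurable (M.noise fstar) :=
  ((M.measurable_of_mem _ fstar.2).comp measurable_fst).sub measurable_snd

theorem memLp_noise (fstar : M.V) : MemLp (M.noise fstar) 2 M.law :=
  ((M.memLp_of_mem _ fstar.2).comp_measurePreserving M.measurePreserving_fst_law).sub
    M.memLp_response

theorem memLp_comp_fst (a : Lp ℝ 2 M.μ) : MemLp (fun z : 𝓧 × ℝ => a z.1) 2 M.law :=
  (Lp.memLp a).comp_measurePreserving M.measurePreserving_fst_law

/-- It is the inner product with the noise after an isometric pull-back along the first projection.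
Continuity makes the centred multiplier process admissible in `MeasurableSuprema`. -/
theorem continuous_noiseMean (fstar : M.V) : Continuous (M.noiseMean fstar) := by
  have e : M.noiseMean fstar = fun a => inner ℝ ((M.memLp_noise fstar).toLp _)
      (Lp.compMeasurePreserving Prod.fst M.measurePreserving_fst_law a) := by
    funext a
    rw [L2.inner_def]
    refine integral_congr_ae ?_
    filter_upwards [(M.memLp_noise fstar).coeFn_toLp,
      Lp.coeFn_compMeasurePreserving a M.measurePreserving_fst_law] with z h1 h2
    rw [h1, h2]
    simp [mul_comm]
  rw [e]
  exact continuous_const.inner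
    (Lp.isometry_compMeasurePreserving M.measurePreserving_fst_law).continuous

theorem toL2_sub_coe (f h : M.V) : ∀ᵐ z ∂M.law,
    (M.toL2 f - M.toL2 h : Lp ℝ 2 M.μ) z.1 = (f : 𝓧 → ℝ) z.1 - (h : 𝓧 → ℝ) z.1 := by
  refine M.measurePreserving_fst_law.quasiMeasurePreserving.ae (p := fun x =>
    (M.toL2 f - M.toL2 h : Lp ℝ 2 M.μ) x = (f : 𝓧 → ℝ) x - (h : 𝓧 → ℝ) x) ?_
  filter_upwards [M.toL2_coe f, M.toL2_coe h, Lp.coeFn_sub (M.toL2 f) (M.toL2 h)] with x h1 h2 h3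
  rw [h3, Pi.sub_apply, h1, h2]

theorem noiseMean_toL2_sub (fstar f : M.V) :
    M.noiseMean fstar (M.toL2 f - M.toL2 fstar)
      = ∫ z, M.noise fstar z * ((f : 𝓧 → ℝ) z.1 - (fstar : 𝓧 → ℝ) z.1) ∂M.law := by
  refine integral_congr_ae ?_
  filter_upwards [M.toL2_sub_coe f fstar] with z hz
  rw [hz]

/-- The first order optimality condition for the target. -/
theorem IsTarget.noiseMean_nonneg {M : Model 𝓧} {H : Set M.V} {fstar : M.V} (ht : M.IsTarget H fstar) {f : M.V}
    (hf : M.toL2 f ∈ M.hull H) : 0 ≤ M.noiseMean fstar (M.toL2 f - M.toL2 fstar) := by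
  set b := M.toL2 f - M.toL2 fstar with hb
  have hn := M.memLp_noise fstar
  have hbL := M.memLp_comp_fst b
  have hrisk : ∀ t : ℝ, M.risk (M.toL2 fstar + t • b)
      = M.risk (M.toL2 fstar) + (2 * t * M.noiseMean fstar b + t ^ 2 * ∫ z, (b z.1) ^ 2 ∂M.law) := by
    intro t
    have i1 : Integrable (fun z => M.noise fstar z ^ 2) M.law := hn.integrable_sq
    have i2 : Integrable (fun z => M.noise fstar z * b z.1) M.law := hn.integrable_mul hbL
    have i3 : Integrable (fun z : 𝓧 × ℝ => b z.1 ^ 2) M.law := hbL.integrable_sq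
    have e0 : M.risk (M.toL2 fstar) = ∫ z, M.noise fstar z ^ 2 ∂M.law := by
      refine integral_congr_ae ?_
      filter_upwards [M.measurePreserving_fst_law.quasiMeasurePreserving.ae (M.toL2_coe fstar)]
        with z hz
      simp only [noise]
      rw [hz]
    have e1 : M.risk (M.toL2 fstar + t • b)
        = ∫ z, (M.noise fstar z ^ 2 + (2 * t * (M.noise fstar z * b z.1) + t ^ 2 * b z.1 ^ 2))
          ∂M.law := by
      refine integral_congr_ae ?_
      filter_upwards [M.measurePreserving_fst_law.quasiMeasurePreserving.ae (M.toL2_coe fstar),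
        M.measurePreserving_fst_law.quasiMeasurePreserving.ae
          (Lp.coeFn_add (M.toL2 fstar) (t • b)),
        M.measurePreserving_fst_law.quasiMeasurePreserving.ae (Lp.coeFn_smul t b)] with z h1 h2 h3
      rw [h2, Pi.add_apply, h3, Pi.smul_apply, h1, smul_eq_mul]
      simp only [noise]
      ring
    have i4 : Integrable (fun z => 2 * t * (M.noise fstar z * b z.1)) M.law := i2.const_mul _
    have i5 : Integrable (fun z : 𝓧 × ℝ => t ^ 2 * b z.1 ^ 2) M.law := i3.const_mul _
    have i6 : Integrable (fun z => 2 * t * (M.noise fstar z * b z.1) + t ^ 2 * b z.1 ^ 2) M.law :=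
      i4.add i5
    rw [e0, e1, integral_add i1 i6, integral_add i4 i5, integral_const_mul,
      integral_const_mul]
    rfl
  set q := ∫ z, (b z.1) ^ 2 ∂M.law
  have hq : 0 ≤ q := integral_nonneg fun z => sq_nonneg _
  -- The risk is quadratic along the segment and minimal at `t = 0`; its increment is divided by
  -- `t`.
  have key : ∀ t : ℝ, 0 < t → t ≤ 1 → 0 ≤ 2 * M.noiseMean fstar b + t * q := by
    intro t h0 h1
    have h2 := ht.2 _ ((M.convex_hull H).add_smul_sub_mem ht.1 hf ⟨h0.le, h1⟩)
    rw [← hb, hrisk] at h2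
    have h3 : 0 ≤ t * (2 * M.noiseMean fstar b + t * q) := by linarith
    exact nonneg_of_mul_nonneg_right h3 h0
  by_contra hneg
  push Not at hneg
  -- For this `t`, `t * q` is at most minus the mean, so `key` would make a negative mean
  -- nonnegative.
  have h4 := key (min 1 (-M.noiseMean fstar b / (q + 1)))
    (lt_min one_pos (div_pos (by linarith) (by linarith))) (min_le_left _ _)
  have h5 : min 1 (-M.noiseMean fstar b / (q + 1)) * q ≤ -M.noiseMean fstar b := by
    calc _ ≤ (-M.noiseMean fstar b / (q + 1)) * (q + 1) :=
          mul_le_mul (min_le_right _ _) (by linarith) hq (div_nonneg (by linarith) (by linarith))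
      _ = _ := div_mul_cancel₀ _ (by linarith)
  linarith

/-- A Lipschitz functional of `L²` over a probability measure has a continuous mean. -/
theorem continuous_integral_comp {L : ℝ} (φ : ℝ → ℝ) (hφ : ∀ s t, |φ s - φ t| ≤ L * |s - t|)
    (B : ℝ) (hB : ∀ t, |φ t| ≤ B) :
    Continuous fun a : Lp ℝ 2 M.μ => ∫ x, φ (a x) ∂M.μ := by
  have hφc : Continuous φ := by
    refine (LipschitzWith.of_dist_le_mul (K := L.toNNReal) fun s t => ?_).continuous
    rw [Real.dist_eq, Real.dist_eq]
    exact (hφ s t).trans (mul_le_mul_of_nonneg_right (Real.le_coe_toNNReal L) (abs_nonneg _))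
  have hi : ∀ a : Lp ℝ 2 M.μ, Integrable (fun x => φ (a x)) M.μ := fun a =>
    Integrable.of_bound (hφc.comp_aestronglyMeasurable (Lp.aestronglyMeasurable a)) B
      (Filter.Eventually.of_forall fun x => hB _)
  refine (LipschitzWith.of_dist_le_mul (K := L.toNNReal) fun a b => ?_).continuous
  rw [Real.dist_eq, dist_eq_norm, ← integral_sub (hi a) (hi b)]
  have h1 : Integrable (a - b : Lp ℝ 2 M.μ) M.μ := (Lp.memLp (a - b)).integrable one_le_two
  have h2 : ∫ x, |(a - b : Lp ℝ 2 M.μ) x| ∂M.μ ≤ ‖a - b‖ := by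
    have h3 := eLpNorm_le_eLpNorm_of_exponent_le (p := 1) (q := 2) (μ := M.μ) one_le_two
      (Lp.aestronglyMeasurable (a - b))
    have h4 := ENNReal.toReal_mono (Lp.eLpNorm_ne_top (a - b)) h3
    rw [← Lp.norm_def] at h4
    refine le_trans (le_of_eq ?_) h4
    rw [eLpNorm_one_eq_lintegral_enorm, ← integral_norm_eq_lintegral_enorm h1.aestronglyMeasurable]
    rfl
  calc |∫ x, (φ (a x) - φ (b x)) ∂M.μ| ≤ ∫ x, |φ (a x) - φ (b x)| ∂M.μ :=
        abs_integral_le_integral_abs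
    _ ≤ ∫ x, L.toNNReal * |(a - b : Lp ℝ 2 M.μ) x| ∂M.μ := by
        refine integral_mono_ae ((hi a).sub (hi b)).abs (h1.abs.const_mul _) ?_
        filter_upwards [Lp.coeFn_sub a b] with x hx
        rw [hx]
        exact (hφ _ _).trans (mul_le_mul_of_nonneg_right (Real.le_coe_toNNReal L) (abs_nonneg _))
    _ = L.toNNReal * ∫ x, |(a - b : Lp ℝ 2 M.μ) x| ∂M.μ := integral_const_mul _ _
    _ ≤ _ := mul_le_mul_of_nonneg_left h2 L.toNNReal.2

end Model

end PISL

end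

/-! ### The quadratic process: the small-ball method. -/

noncomputable section

namespace PISL

/-- The soft threshold `t ↦ min 1 (2 |t| / a - 1)₊`. -/
def softThreshold (a t : ℝ) : ℝ := min 1 (max 0 (2 / a * |t| - 1))

theorem softThreshold_nonneg (a t : ℝ) : 0 ≤ softThreshold a t := by
  unfold softThreshold; positivity

theorem softThreshold_le_one (a t : ℝ) : softThreshold a t ≤ 1 := min_le_left _ _

theorem abs_softThreshold_le_one (a t : ℝ) : |softThreshold a t| ≤ 1 := by
  rw [abs_of_nonneg (softThreshold_nonneg a t)]
  exact softThreshold_le_one a t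

theorem softThreshold_zero (a : ℝ) : softThreshold a 0 = 0 := by simp [softThreshold]

/-- The Lipschitz property, which an indicator lacks, is what permits contraction to the linear
process. -/
theorem softThreshold_lipschitz {a : ℝ} (ha : 0 < a) (s t : ℝ) :
    |softThreshold a s - softThreshold a t| ≤ 2 / a * |s - t| := by
  have h1 : |softThreshold a s - softThreshold a t|
      ≤ |(2 / a * |s| - 1) - (2 / a * |t| - 1)| := by
    have h2 := abs_min_sub_min_le_max 1 (max 0 (2 / a * |s| - 1)) 1 (max 0 (2 / a * |t| - 1))
    have h3 := abs_max_sub_max_le_max 0 (2 / a * |s| - 1) 0 (2 / a * |t| - 1)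
    exact h2.trans (max_le (by simp) (h3.trans (max_le (by simp) le_rfl)))
  refine h1.trans ?_
  rw [sub_sub_sub_cancel_right, ← mul_sub, abs_mul, abs_of_pos (by positivity : 0 < 2 / a)]
  exact mul_le_mul_of_nonneg_left (abs_abs_sub_abs_le _ _) (by positivity)

theorem continuous_softThreshold (a : ℝ) : Continuous (softThreshold a) := by
  unfold softThreshold; fun_prop

theorem softThreshold_eq_one {a t : ℝ} (ha : 0 < a) (h : a ≤ |t|) : softThreshold a t = 1 := by
  refine min_eq_left (le_max_of_le_right ?_)
  have : 2 / a * a ≤ 2 / a * |t| := mul_le_mul_of_nonneg_left h (by positivity)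
  rw [div_mul_cancel₀ _ ha.ne'] at this
  linarith

/-- The threshold vanishes for `|t| ≤ a / 2` and is at most one beyond, so empirical means of
thresholds bound empirical second moments from below. -/
theorem mul_softThreshold_le_sq {a : ℝ} (ha : 0 < a) (t : ℝ) :
    (a / 2) ^ 2 * softThreshold a t ≤ t ^ 2 := by
  by_cases h : a / 2 ≤ |t|
  · calc _ ≤ (a / 2) ^ 2 * 1 :=
        mul_le_mul_of_nonneg_left (softThreshold_le_one _ _) (by positivity)
      _ ≤ t ^ 2 := by
        rw [mul_one, ← sq_abs t]
        exact pow_le_pow_left₀ (by positivity) h 2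
  · have h1 : 2 / a * |t| - 1 ≤ 0 := by
      have : 2 / a * |t| ≤ 2 / a * (a / 2) :=
        mul_le_mul_of_nonneg_left (not_le.1 h).le (by positivity)
      have e : 2 / a * (a / 2) = 1 := by field_simp
      linarith
    have h2 : softThreshold a t = 0 := by
      simp [softThreshold, max_eq_left h1]
    rw [h2, mul_zero]
    positivity

namespace Model

variable {𝓧 : Type*} [MeasurableSpace 𝓧] (M : Model 𝓧)

theorem measurable_coe (f : M.V) : Measurable (f : 𝓧 → ℝ) := M.measurable_of_mem _ f.2

/-- The factor that shrinks `f - f*` to norm at most `s`. -/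
def shrink (fstar : M.V) (s : ℝ) (a : Lp ℝ 2 M.μ) : ℝ := s / max ‖a - M.toL2 fstar‖ s

theorem shrink_pos (fstar : M.V) {s : ℝ} (hs : 0 < s) (a : Lp ℝ 2 M.μ) :
    0 < M.shrink fstar s a := div_pos hs (lt_max_of_lt_right hs)

theorem shrink_le_one (fstar : M.V) {s : ℝ} (hs : 0 < s) (a : Lp ℝ 2 M.μ) :
    M.shrink fstar s a ≤ 1 := (div_le_one (lt_max_of_lt_right hs)).2 (le_max_right _ _)

theorem shrink_mul_le (fstar : M.V) {s : ℝ} (hs : 0 < s) (a : Lp ℝ 2 M.μ) :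
    M.shrink fstar s a * ‖a - M.toL2 fstar‖ ≤ s := by
  calc _ ≤ M.shrink fstar s a * max ‖a - M.toL2 fstar‖ s :=
        mul_le_mul_of_nonneg_left (le_max_left _ _) (M.shrink_pos fstar hs a).le
    _ = s := div_mul_cancel₀ _ (lt_max_of_lt_right hs).ne'

theorem continuous_shrink (fstar : M.V) {s : ℝ} (hs : 0 < s) : Continuous (M.shrink fstar s) := by
  unfold shrink
  exact continuous_const.div (by fun_prop) fun a => (lt_max_of_lt_right hs).ne'

theorem lintegral_signSampleLaw {n : ℕ} (G : (Fin n → Bool) → (Fin n → 𝓧 × ℝ) → ℝ≥0∞)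
    (hG : ∀ σ, Measurable (G σ)) :
    ∫⁻ p, G p.1 p.2 ∂M.signSampleLaw n = (2 ^ n)⁻¹ * ∑ σ, ∫⁻ S, G σ S ∂M.sampleLaw n := by
  have hm : Measurable fun p : (Fin n → Bool) × (Fin n → 𝓧 × ℝ) => G p.1 p.2 :=
    measurable_from_prod_countable_right fun σ => hG σ
  have : SFinite (M.sampleLaw n) := by unfold sampleLaw; infer_instance
  rw [signSampleLaw, lintegral_prod _ hm.aemeasurable, lintegral_fintype, Finset.mul_sum]
  refine Finset.sum_congr rfl fun σ _ => ?_
  rw [mul_comm, PMF.toMeasure_apply_singleton _ _ (MeasurableSet.singleton _),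
    PMF.uniformOfFintype_apply]
  simp

/-- The lower bound on the quadratic process over a localized class, by the small-ball method. -/
theorem SmallBall.exists_event {M : Model 𝓧} {H : Set M.V} {κ ε : ℝ}
    (hSB : M.SmallBall (M.hull H) κ ε) (hκ : 0 < κ) (hε : 0 < ε) (hmeas : M.MeasurableSuprema H)
    {fstar : M.V} (hstar : M.toL2 fstar ∈ M.hull H) {n : ℕ} (hn : 0 < n) {ρ : ℝ} (hρ : 0 < ρ)
    {s : ℝ} (hs : 0 < s)
    (hrad : ∫⁻ p, M.radSup n (M.penaltyClass H fstar ρ) fstar (ENNReal.ofReal s) p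
      ∂M.signSampleLaw n ≤ ENNReal.ofReal (κ * ε / 32 * s)) :
    ∃ E : Set (Fin n → 𝓧 × ℝ), MeasurableSet E ∧
      1 - Real.exp (-(n * ε ^ 2 / 2)) ≤ (M.sampleLaw n).real E ∧
      ∀ S ∈ E, ∀ f : M.V, M.toL2 f ∈ M.hull H → M.Psi f - M.Psi fstar < ρ →
        s ≤ ‖M.toL2 f - M.toL2 fstar‖ →
        κ ^ 2 * ε / 16 * ‖M.toL2 f - M.toL2 fstar‖ ^ 2
          ≤ (n : ℝ)⁻¹ * ∑ i, ((f : 𝓧 → ℝ) (S i).1 - (fstar : 𝓧 → ℝ) (S i).1) ^ 2 := by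
  have hn' : (0 : ℝ) < n := by exact_mod_cast hn
  have hκs : 0 < κ * s := mul_pos hκ hs
  let w : Lp ℝ 2 M.μ × Lp ℝ 2 M.μ → ℝ := fun v => ρ - (‖v.2 - M.g‖ - M.Psi fstar)
  have hw : Continuous w := by simp only [w]; fun_prop
  let ι := {f : M.V // M.toL2 f ∈ M.hull H ∧ 0 < w (M.toL2 f, M.D f)}
  let φ : ℝ → ℝ := softThreshold (κ * s)
  have hφc : Continuous φ := continuous_softThreshold _
  -- Every `f` is pulled into the ball of radius `s`; the factor is continuous in `f`, as
  -- measurability of the suprema requires.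
  let c : ι → ℝ := fun f => M.shrink fstar s (M.toL2 f.1)
  let u : ι → 𝓧 × ℝ → ℝ := fun f z => c f * ((f.1 : 𝓧 → ℝ) z.1 - (fstar : 𝓧 → ℝ) z.1)
  let h : ι → 𝓧 × ℝ → ℝ := fun f z => φ (u f z)
  let mean : Lp ℝ 2 M.μ → ℝ := fun a =>
    ∫ x, φ ((M.shrink fstar s a • (a - M.toL2 fstar) : Lp ℝ 2 M.μ) x) ∂M.μ
  have hmeanc : Continuous mean :=
    (M.continuous_integral_comp φ (softThreshold_lipschitz hκs) 1
      (abs_softThreshold_le_one _)).comp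
      ((M.continuous_shrink fstar hs).smul (continuous_id.sub continuous_const))
  have hum : ∀ f, Measurable (u f) := fun f =>
    (((M.measurable_coe f.1).comp measurable_fst).sub
      ((M.measurable_coe fstar).comp measurable_fst)).const_mul _
  have hhm : ∀ f, Measurable (h f) := fun f => hφc.measurable.comp (hum f)
  have hmean : ∀ f : ι, ∫ z, h f z ∂M.law = mean (M.toL2 f.1) := by
    intro f
    have h1 : mean (M.toL2 f.1) = ∫ z, φ ((M.shrink fstar s (M.toL2 f.1) •
        (M.toL2 f.1 - M.toL2 fstar) : Lp ℝ 2 M.μ) z.1) ∂M.law :=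
      (integral_map measurable_fst.aemeasurable
        (hφc.comp_aestronglyMeasurable (Lp.aestronglyMeasurable _)))
    rw [h1]
    refine integral_congr_ae ?_
    filter_upwards [M.toL2_sub_coe f.1 fstar,
      M.measurePreserving_fst_law.quasiMeasurePreserving.ae
        (Lp.coeFn_smul (M.shrink fstar s (M.toL2 f.1)) (M.toL2 f.1 - M.toL2 fstar))] with z h2 h3
    rw [h3, Pi.smul_apply, h2, smul_eq_mul]
  let D : (Fin n → 𝓧 × ℝ) → ℝ≥0∞ := fun S =>
    ⨆ f : ι, ENNReal.ofReal (∑ i, (∫ z, h f z ∂M.law - h f (S i)))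
  have hDm : Measurable D := by
    have h1 := hmeas.measurable_iSup n (fun S v => ∑ i, (mean v.2.1
      - φ (M.shrink fstar s v.2.1 * (v.1 i - (fstar : 𝓧 → ℝ) (S i).1))))
      (fun v => by
        have := M.measurable_coe fstar
        refine Finset.measurable_sum _ fun i _ => measurable_const.sub (hφc.measurable.comp ?_)
        fun_prop)
      (fun S => by
        have := M.continuous_shrink fstar hs
        fun_prop) w hw
    simp only [D, hmean]
    exact h1
  have hterm : ∀ (f : ι) (S : Fin n → 𝓧 × ℝ), ∑ i, (∫ z, h f z ∂M.law - h f (S i)) ≤ n := by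
    intro f S
    have h1 : ∫ z, h f z ∂M.law ≤ 1 := by
      calc ∫ z, h f z ∂M.law ≤ ∫ _z, (1 : ℝ) ∂M.law :=
            integral_mono (Integrable.of_bound (hhm f).aestronglyMeasurable 1
              (Filter.Eventually.of_forall fun z => abs_softThreshold_le_one _ _))
              (integrable_const _) fun z => softThreshold_le_one _ _
        _ = 1 := by simp
    calc _ ≤ ∑ _i : Fin n, (1 : ℝ) := Finset.sum_le_sum fun i _ => by
          have := softThreshold_nonneg (κ * s) (u f (S i))
          simp only [h, φ] at h1 ⊢
          linarith
      _ = n := by simp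
  have hDn : ∀ S, D S ≤ n := fun S => iSup_le fun f => by
    rw [← ENNReal.ofReal_natCast]
    exact ENNReal.ofReal_le_ofReal (hterm f S)
  have hDtop : ∀ S, D S ≠ ∞ := fun S => ne_top_of_le_ne_top (ENNReal.natCast_ne_top n) (hDn S)
  -- Symmetrization costs 2, contraction `2 / (κ s)`, and the Rademacher average is at most `κ ε s /
  -- 32`: per observation, `ε / 8`.
  have hDint : ∫⁻ S, D S ∂M.sampleLaw n ≤ ENNReal.ofReal (n * ε / 8) := by
    have hsup : ∀ (m : ℕ) (a : Fin m → ℝ), Measurable fun S : Fin m → 𝓧 × ℝ =>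
        ⨆ f : ι, ENNReal.ofReal (∑ i, a i * h f (S i)) := fun m a =>
      hmeas.measurable_iSup m (fun S v => ∑ i, a i *
        φ (M.shrink fstar s v.2.1 * (v.1 i - (fstar : 𝓧 → ℝ) (S i).1)))
        (fun v => by
          have := M.measurable_coe fstar
          refine Finset.measurable_sum _ fun i _ => (hφc.measurable.comp ?_).const_mul _
          fun_prop)
        (fun S => by
          have := M.continuous_shrink fstar hs
          fun_prop) w hw
    let G : (Fin n → Bool) → (Fin n → 𝓧 × ℝ) → ℝ≥0∞ := fun σ S =>
      ⨆ f : ι, ENNReal.ofReal ((n : ℝ)⁻¹ * ∑ i, sign (σ i) * u f (S i))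
    have hG : ∀ σ, Measurable (G σ) := fun σ =>
      hmeas.measurable_iSup n (fun S v => (n : ℝ)⁻¹ * ∑ i, sign (σ i) *
        (M.shrink fstar s v.2.1 * (v.1 i - (fstar : 𝓧 → ℝ) (S i).1)))
        (fun v => by
          have := M.measurable_coe fstar
          refine (Finset.measurable_sum _ fun i _ => ?_).const_mul _
          fun_prop)
        (fun S => by
          have := M.continuous_shrink fstar hs
          fun_prop) w hw
    have hGr : ∫⁻ p, G p.1 p.2 ∂M.signSampleLaw n ≤ ENNReal.ofReal (κ * ε / 32 * s) := by
      refine le_trans (lintegral_mono fun p => iSup_le fun f => ?_) hrad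
      have hc0 : 0 < c f := M.shrink_pos fstar hs _
      have hc1 : c f ≤ 1 := M.shrink_le_one fstar hs _
      have hfρ : M.Psi f.1 - M.Psi fstar < ρ := sub_pos.1 f.2.2
      refine (Real.ofReal_le_enorm _).trans ?_
      have e : ∑ i, sign (p.1 i) * u f (p.2 i) = ∑ i, sign (p.1 i) *
          ((M.seg fstar f.1 (c f) : 𝓧 → ℝ) (p.2 i).1 - (fstar : 𝓧 → ℝ) (p.2 i).1) := by
        simp only [seg_apply, u]
      rw [e]
      refine le_iSup₂_of_le (M.seg fstar f.1 (c f)) ⟨⟨?_, ?_⟩, ?_⟩ le_rfl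
      · exact M.seg_mem_hull hstar f.2.1 hc0.le hc1
      · refine (M.Psi_seg_sub_le fstar f.1 hc0.le hc1).trans ?_
        calc c f * (M.Psi f.1 - M.Psi fstar) ≤ c f * ρ :=
              mul_le_mul_of_nonneg_left hfρ.le hc0.le
          _ ≤ ρ := mul_le_of_le_one_left hρ.le hc1
      · rw [← ofReal_norm, M.norm_toL2_seg_sub fstar f.1 hc0.le]
        exact ENNReal.ofReal_le_ofReal (M.shrink_mul_le fstar hs _)
    rw [M.lintegral_signSampleLaw G hG] at hGr
    -- The target itself is the zero element needed by the contraction principle.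
    let s₀ : ι := ⟨fstar, hstar, by
      have : M.Psi fstar = ‖M.D fstar - M.g‖ := rfl
      simp only [w]
      linarith⟩
    have hu₀ : ∀ z, u s₀ z = 0 := fun z => by simp [u, s₀]
    have hcontr : ∀ S : Fin n → 𝓧 × ℝ,
        ∑ σ : Fin n → Bool, ⨆ f : ι, ENNReal.ofReal (∑ i, sign (σ i) * h f (S i))
          ≤ ENNReal.ofReal (2 / (κ * s) * n) * ∑ σ, G σ S := by
      intro S
      refine (sum_iSup_sign_le (fun (f : ι) i => h f (S i))
        (fun (f : ι) i => 2 / (κ * s) * u f (S i)) s₀ (fun i => ?_) (fun i => ?_)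
        fun i f f' => ?_).trans (le_of_eq ?_)
      · simp only [h, hu₀]
        exact softThreshold_zero _
      · simp only [hu₀, mul_zero]
      · rw [← mul_sub, abs_mul, abs_of_pos (by positivity : 0 < 2 / (κ * s))]
        exact softThreshold_lipschitz hκs _ _
      · rw [Finset.mul_sum]
        refine Finset.sum_congr rfl fun σ _ => ?_
        rw [ENNReal.mul_iSup]
        refine iSup_congr fun f => ?_
        rw [← ENNReal.ofReal_mul (by positivity)]
        congr 1
        have e : ∀ i, sign (σ i) * (2 / (κ * s) * u f (S i))
            = 2 / (κ * s) * (sign (σ i) * u f (S i)) := fun i => by ring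
        simp only [e]
        rw [← Finset.mul_sum]
        field_simp
    have h1 := two_pow_mul_lintegral_iSup_deviation_le M.law (n := n) h hhm 1
      (fun f z => abs_softThreshold_le_one _ _) hsup
    have h2 : ∫⁻ S, ∑ σ : Fin n → Bool, ⨆ f : ι, ENNReal.ofReal (∑ i, sign (σ i) * h f (S i))
        ∂M.sampleLaw n ≤ ENNReal.ofReal (2 / (κ * s) * n) * ∑ σ, ∫⁻ S, G σ S ∂M.sampleLaw n := by
      refine (lintegral_mono hcontr).trans (le_of_eq ?_)
      rw [lintegral_const_mul _ (Finset.measurable_sum _ fun σ _ => hG σ),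
        lintegral_finsetSum _ fun σ _ => hG σ]
    have hp0 : (2 ^ n : ℝ≥0∞) ≠ 0 := by positivity
    have hpt : (2 ^ n : ℝ≥0∞) ≠ ∞ := ENNReal.pow_ne_top ENNReal.ofNat_ne_top
    have h3 : ∑ σ, ∫⁻ S, G σ S ∂M.sampleLaw n ≤ 2 ^ n * ENNReal.ofReal (κ * ε / 32 * s) := by
      rw [mul_comm, ← ENNReal.div_le_iff_le_mul (Or.inl hp0) (Or.inl hpt), ENNReal.div_eq_inv_mul]
      exact hGr
    have h4 : 2 ^ n * ∫⁻ S, D S ∂M.sampleLaw n ≤ 2 ^ n * ENNReal.ofReal (n * ε / 8) := by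
      calc _ ≤ 2 * (ENNReal.ofReal (2 / (κ * s) * n)
            * (2 ^ n * ENNReal.ofReal (κ * ε / 32 * s))) :=
            h1.trans (mul_le_mul_right (h2.trans (mul_le_mul_right h3 _)) _)
        _ = 2 ^ n * (ENNReal.ofReal 2 * (ENNReal.ofReal (2 / (κ * s) * n)
            * ENNReal.ofReal (κ * ε / 32 * s))) := by
            rw [ENNReal.ofReal_ofNat]
            ring
        _ = _ := by
            rw [← ENNReal.ofReal_mul (by positivity), ← ENNReal.ofReal_mul (by positivity)]
            congr 2
            field_simp
            ring
    exact (ENNReal.mul_le_mul_iff_right hp0 hpt).1 h4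
  let F : (Fin n → 𝓧 × ℝ) → ℝ := fun S => (n : ℝ)⁻¹ * (D S).toReal
  have hFm : Measurable F := hDm.ennreal_toReal.const_mul _
  have hFB : ∀ S, |F S| ≤ 1 := by
    intro S
    rw [abs_of_nonneg (by positivity)]
    have h1 := ENNReal.toReal_mono (ENNReal.natCast_ne_top n) (hDn S)
    rw [ENNReal.toReal_natCast] at h1
    calc F S ≤ (n : ℝ)⁻¹ * n := mul_le_mul_of_nonneg_left h1 (by positivity)
      _ = 1 := inv_mul_cancel₀ hn'.ne'
  have hFint : ∫ S, F S ∂M.sampleLaw n ≤ ε / 8 := by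
    have h1 : ∫ S, (D S).toReal ∂M.sampleLaw n ≤ n * ε / 8 := by
      rw [integral_toReal hDm.aemeasurable (Filter.Eventually.of_forall fun S => (hDtop S).lt_top)]
      exact ENNReal.toReal_le_of_le_ofReal (by positivity) hDint
    simp only [F]
    rw [integral_const_mul, inv_mul_le_iff₀ hn']
    linarith
  -- Thresholds lie in `[0, 1]`, so one observation changes the sum by at most 1.
  have hFd : ∀ S i z, F (Function.update S i z) - F S ≤ (n : ℝ)⁻¹ := by
    intro S i z
    have h1 : D (Function.update S i z) ≤ D S + 1 := by
      refine iSup_le fun f => ?_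
      have h2 : ∑ j, (∫ z, h f z ∂M.law - h f (Function.update S i z j))
          ≤ ∑ j, (∫ z, h f z ∂M.law - h f (S j)) + 1 := by
        rw [← Finset.sum_erase_add _ _ (Finset.mem_univ i),
          ← Finset.sum_erase_add Finset.univ (fun j => ∫ z, h f z ∂M.law - h f (S j)) (Finset.mem_univ i)]
        have h3 : ∑ j ∈ Finset.univ.erase i, (∫ z, h f z ∂M.law - h f (Function.update S i z j))
            = ∑ j ∈ Finset.univ.erase i, (∫ z, h f z ∂M.law - h f (S j)) :=
          Finset.sum_congr rfl fun j hj => by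
            rw [Function.update_of_ne (Finset.ne_of_mem_erase hj)]
        rw [h3, Function.update_self]
        have h4 := softThreshold_nonneg (κ * s) (u f z)
        have h5 := softThreshold_le_one (κ * s) (u f (S i))
        simp only [h, φ] at h4 h5 ⊢
        linarith
      refine (ENNReal.ofReal_le_ofReal h2).trans (ENNReal.ofReal_add_le.trans ?_)
      rw [ENNReal.ofReal_one]
      exact add_le_add_left (le_iSup
        (fun f : ι => ENNReal.ofReal (∑ j, (∫ z, h f z ∂M.law - h f (S j)))) f) _
    have h2 := ENNReal.toReal_mono (ENNReal.add_ne_top.2 ⟨hDtop S, ENNReal.one_ne_top⟩) h1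
    rw [ENNReal.toReal_add (hDtop S) ENNReal.one_ne_top, ENNReal.toReal_one] at h2
    simp only [F]
    rw [← mul_sub]
    exact mul_le_of_le_one_right (by positivity) (by linarith)
  let m := ∫ S, F S ∂M.sampleLaw n
  -- A deviation of `ε / 2` has probability at most `exp (-2n (ε / 2)²) = exp (-n ε² / 2)`.
  have hE : MeasurableSet {S | ε / 2 ≤ F S - m} :=
    measurableSet_le measurable_const (hFm.sub_const _)
  have : IsProbabilityMeasure (M.sampleLaw n) := by unfold sampleLaw; infer_instance
  refine ⟨{S | ε / 2 ≤ F S - m}ᶜ, hE.compl, ?_, ?_⟩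
  · have h1 := measure_ge_le_of_bounded_differences M.law hn F hFm 1 hFB (half_pos hε).le hFd
    rw [probReal_compl_eq_one_sub hE]
    have e : -(2 * n * (ε / 2) ^ 2) = -(n * ε ^ 2 / 2) := by ring
    rw [e] at h1
    exact sub_le_sub_left h1 1
  · intro S hS f hf hfρ hfs
    have hS' : F S < ε / 2 + ε / 8 := by
      have : F S - m < ε / 2 := not_le.1 hS
      linarith
    have hDS : (D S).toReal < n * (5 * ε / 8) := by
      have := (inv_mul_lt_iff₀ hn').1 hS'
      linarith
    let f' : ι := ⟨f, hf, by
      have : M.Psi f = ‖M.D f - M.g‖ := rfl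
      simp only [w]
      linarith⟩
    have h1 : ∑ i, (∫ z, h f' z ∂M.law - h f' (S i)) ≤ (D S).toReal :=
      (ENNReal.ofReal_le_iff_le_toReal (hDtop S)).1
        (le_iSup (fun f : ι => ENNReal.ofReal (∑ j, (∫ z, h f z ∂M.law - h f (S j)))) f')
    set d := ‖M.toL2 f - M.toL2 fstar‖ with hd
    have hd0 : 0 < d := hs.trans_le hfs
    have hcd : c f' = s / d := by
      simp only [c, shrink, f']
      rw [← hd, max_eq_left hfs]
    -- As `d ≥ s`, the shrunk function has norm exactly `s`; its threshold equals 1 on the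
    -- small-ball event, and Markov's inequality at level 1 applies.
    have hmean_ge : ε ≤ ∫ z, h f' z ∂M.law := by
      rw [hmean]
      have hA := hSB (M.toL2 f) hf (M.toL2 fstar) hstar
      rw [← hd] at hA
      let b : Lp ℝ 2 M.μ := M.shrink fstar s (M.toL2 f) • (M.toL2 f - M.toL2 fstar)
      have hle : M.μ {x | κ * d ≤ |M.toL2 f x - M.toL2 fstar x|} ≤ M.μ {x | 1 ≤ φ (b x)} := by
        refine measure_mono_ae ?_
        filter_upwards [Lp.coeFn_smul (M.shrink fstar s (M.toL2 f)) (M.toL2 f - M.toL2 fstar),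
          Lp.coeFn_sub (M.toL2 f) (M.toL2 fstar)] with x h2 h3 (hx : κ * d ≤ _)
        refine (softThreshold_eq_one hκs ?_).ge
        have hcs : M.shrink fstar s (M.toL2 f) = s / d := hcd
        rw [h2, Pi.smul_apply, h3, Pi.sub_apply, smul_eq_mul, abs_mul, hcs,
          abs_of_pos (by positivity : 0 < s / d)]
        calc κ * s = s / d * (κ * d) := by field_simp
          _ ≤ _ := mul_le_mul_of_nonneg_left hx (by positivity)
      have hmk := mul_meas_ge_le_integral_of_nonneg (μ := M.μ) (f := fun x => φ (b x))
        (Filter.Eventually.of_forall fun x => softThreshold_nonneg _ _)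
        (Integrable.of_bound (hφc.comp_aestronglyMeasurable (Lp.aestronglyMeasurable b)) 1
          (Filter.Eventually.of_forall fun x => abs_softThreshold_le_one _ _)) 1
      rw [one_mul] at hmk
      exact (ENNReal.ofReal_le_iff_le_toReal (measure_ne_top _ _)).1 (hA.trans hle) |>.trans hmk
    rw [Finset.sum_sub_distrib] at h1
    simp only [Finset.sum_const, Finset.card_univ, Fintype.card_fin, nsmul_eq_mul] at h1
    -- `3/8 = 1 - 1/2 - 1/8`: the small-ball mean less the deviation and the expected supremum.
    have h2 : n * (3 * ε / 8) ≤ ∑ i, h f' (S i) := by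
      have := mul_le_mul_of_nonneg_left hmean_ge hn'.le
      linarith
    have h3 : ∀ i, (κ * s / 2) ^ 2 * h f' (S i)
        ≤ (s / d) ^ 2 * ((f : 𝓧 → ℝ) (S i).1 - (fstar : 𝓧 → ℝ) (S i).1) ^ 2 := by
      intro i
      rw [← mul_pow, ← hcd]
      exact mul_softThreshold_le_sq hκs _
    have h4 := Finset.sum_le_sum fun i (_ : i ∈ Finset.univ) => h3 i
    rw [← Finset.mul_sum, ← Finset.mul_sum] at h4
    set Q := ∑ i, ((f : 𝓧 → ℝ) (S i).1 - (fstar : 𝓧 → ℝ) (S i).1) ^ 2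
    rw [← div_eq_inv_mul, le_div_iff₀ hn']
    have h5 : (κ * s / 2) ^ 2 * (n * (3 * ε / 8)) ≤ (s / d) ^ 2 * Q :=
      (mul_le_mul_of_nonneg_left h2 (by positivity)).trans h4
    have h6 : (d / s) ^ 2 * ((κ * s / 2) ^ 2 * (n * (3 * ε / 8))) ≤ Q := by
      calc _ ≤ (d / s) ^ 2 * ((s / d) ^ 2 * Q) := mul_le_mul_of_nonneg_left h5 (by positivity)
        _ = Q := by field_simp
    -- Undoing the shrinking leaves the constant `(1/4)(3/8) = 3/32`, which exceeds `1/16`.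
    have h7 : (d / s) ^ 2 * ((κ * s / 2) ^ 2 * (n * (3 * ε / 8)))
        = κ ^ 2 * ε * (3 / 32) * d ^ 2 * n := by field_simp; ring
    rw [h7] at h6
    refine le_trans ?_ h6
    have : 0 ≤ κ ^ 2 * ε * d ^ 2 * n := by positivity
    linarith

end Model

end PISL

end

/-! ### The multiplier process at vanishing penalty scales. -/

noncomputable section

namespace PISL

/-- A nontrivial Rademacher sum vanishes with probability at most one half. -/
theorem toMeasure_sum_sign_eq_zero_le {n : ℕ} (c : Fin n → ℝ) {i : Fin n} (hi : c i ≠ 0) :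
    (PMF.uniformOfFintype (Fin n → Bool)).toMeasure {σ | ∑ j, sign (σ j) * c j = 0} ≤ 2⁻¹ := by
  classical
  let A : Finset (Fin n → Bool) := {σ | ∑ j, sign (σ j) * c j = 0}
  have hA : ({σ | ∑ j, sign (σ j) * c j = 0} : Set (Fin n → Bool)) = A := by
    ext σ
    simp [A]
  -- Flipping sign `i` changes the sum by `±2 c i ≠ 0`, so it maps the zero set into its complement.
  have hdisj : Disjoint A (A.map (flipAt i).toEmbedding) := by
    rw [Finset.disjoint_left]
    intro σ hσ hσ'
    obtain ⟨σ', h', rfl⟩ := Finset.mem_map.1 hσ'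
    have h1 : ∑ j, sign (flipAt i σ' j) * c j = 0 := (Finset.mem_filter.1 hσ).2
    have h2 : ∑ j, sign (σ' j) * c j = 0 := (Finset.mem_filter.1 h').2
    rw [sum_sign_flipAt] at h1
    rw [sum_sign_eq i] at h2
    have h3 : sign (σ' i) * c i = 0 := by linarith
    have h4 := abs_sign (σ' i)
    rcases mul_eq_zero.1 h3 with h | h
    · rw [h, abs_zero] at h4
      exact zero_ne_one h4
    · exact hi h
  have hcard : A.card * 2 ≤ Fintype.card (Fin n → Bool) := by
    have h1 := Finset.card_le_univ (A ∪ A.map (flipAt i).toEmbedding)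
    rw [Finset.card_union_of_disjoint hdisj, Finset.card_map] at h1
    omega
  rw [hA, PMF.toMeasure_uniformOfFintype_apply _ (Set.toFinite _).measurableSet]
  simp only [Fintype.card_coe, Finset.coe_sort_coe]
  have h0 : (Fintype.card (Fin n → Bool) : ℝ≥0∞) ≠ 0 := by
    exact_mod_cast Fintype.card_ne_zero
  rw [ENNReal.div_le_iff h0 (ENNReal.natCast_ne_top _), ← ENNReal.div_eq_inv_mul,
    ENNReal.le_div_iff_mul_le (Or.inl two_ne_zero) (Or.inl ENNReal.ofNat_ne_top)]
  exact_mod_cast hcard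

namespace Model

variable {𝓧 : Type*} [MeasurableSpace 𝓧] {M : Model 𝓧}

/-- The open constraint defining the functions at distance less than `s` from the target whose
penalty exceeds that of the target by less than `ρ`. -/
def gap (M : Model 𝓧) (fstar : M.V) (ρ s : ℝ) (v : Lp ℝ 2 M.μ × Lp ℝ 2 M.μ) : ℝ :=
  min (ρ - (‖v.2 - M.g‖ - M.Psi fstar)) (s - ‖v.1 - M.toL2 fstar‖)

theorem continuous_gap (fstar : M.V) (ρ s : ℝ) : Continuous (M.gap fstar ρ s) := by
  unfold gap; fun_prop

theorem gap_pos_iff (fstar f : M.V) (ρ s : ℝ) : 0 < M.gap fstar ρ s (M.toL2 f, M.D f) ↔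
    M.Psi f - M.Psi fstar < ρ ∧ ‖M.toL2 f - M.toL2 fstar‖ < s := by
  have : M.Psi f = ‖M.D f - M.g‖ := rfl
  rw [gap, lt_min_iff, sub_pos, sub_pos, this]

theorem mem_localClass_of_gap_pos {H : Set M.V} {fstar f : M.V} {ρ s : ℝ}
    (hf : M.toL2 f ∈ M.hull H) (h : 0 < M.gap fstar ρ s (M.toL2 f, M.D f)) {r : ℝ≥0∞}
    (hr : ENNReal.ofReal s ≤ r) : f ∈ M.localClass (M.penaltyClass H fstar ρ) fstar r := by
  obtain ⟨h1, h2⟩ := (M.gap_pos_iff fstar f ρ s).1 h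
  refine ⟨⟨hf, h1.le⟩, le_trans ?_ hr⟩
  rw [← ofReal_norm]
  exact ENNReal.ofReal_le_ofReal h2.le

/-- If, along a sequence `ρ k → 0`, the radii `r (ρ k)` are much larger than `ρ k`, then the
deviation of the multiplier process at `f` is at most `τ λ (Ψ(f) - Ψ(f*))₊`. -/
theorem exists_multiplier_event_of_lt {H : Set M.V} (hmeas : M.MeasurableSuprema H) {fstar : M.V}
    (htarget : M.IsTarget H fstar) {n : ℕ} {δ τ lam : ℝ} (hτ : 0 < τ) {r : ℝ → ℝ≥0∞}
    (hlam : M.lambda0 n H fstar r δ τ < ENNReal.ofReal lam)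
    (hr : ∀ k : ℕ, ∃ ρ : ℝ, 0 < ρ ∧ ρ < 1 / (k + 1) ∧ ENNReal.ofReal (k * ρ) < r ρ) :
    ∃ E : Set (Fin n → 𝓧 × ℝ), MeasurableSet E ∧ ENNReal.ofReal (1 - δ) ≤ M.sampleLaw n E ∧
      ∀ S ∈ E, ∀ f : M.V, M.toL2 f ∈ M.hull H → ∀ ψ : ℝ, 0 < ψ → M.Psi f - M.Psi fstar < ψ →
        -(τ * lam * ψ) ≤ (n : ℝ)⁻¹ * ∑ i, M.noise fstar (S i) *
          ((f : 𝓧 → ℝ) (S i).1 - (fstar : 𝓧 → ℝ) (S i).1) := by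
  choose ρ hρ0 hρ1 hρr using hr
  -- The radius `k ρ k` is finite and below `r (ρ k)`, and it grows relative to the penalty scale.
  let ι : ℕ → Type _ := fun k =>
    {f : M.V // M.toL2 f ∈ M.hull H ∧ 0 < M.gap fstar (ρ k) (k * ρ k) (M.toL2 f, M.D f)}
  let dev : M.V → (Fin n → 𝓧 × ℝ) → ℝ := fun f S => (n : ℝ)⁻¹ * ∑ i, M.noise fstar (S i) *
    ((f : 𝓧 → ℝ) (S i).1 - (fstar : 𝓧 → ℝ) (S i).1)
    - M.noiseMean fstar (M.toL2 f - M.toL2 fstar)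
  let O : ℕ → (Fin n → 𝓧 × ℝ) → ℝ≥0∞ := fun k S => ⨆ f : ι k, ENNReal.ofReal |dev f.1 S|
  have hO : ∀ k, Measurable (O k) := fun k =>
    hmeas.measurable_iSup n (fun S v => |(n : ℝ)⁻¹ * ∑ i, M.noise fstar (S i) *
        (v.1 i - (fstar : 𝓧 → ℝ) (S i).1) - M.noiseMean fstar (v.2.1 - M.toL2 fstar)|)
      (fun v => by
        have h1 := M.measurable_coe fstar
        have h2 := M.measurable_noise fstar
        refine ((Measurable.const_mul (Finset.measurable_sum _ fun i _ => ?_) _).sub_const _).abs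
        fun_prop)
      (fun S => by
        have := M.continuous_noiseMean fstar
        fun_prop) _ (continuous_gap fstar _ _)
  let E : ℕ → Set (Fin n → 𝓧 × ℝ) := fun k => {S | O k S ≤ ENNReal.ofReal (τ * lam * ρ k)}
  have hE : ∀ k, MeasurableSet (E k) := fun k => measurableSet_le (hO k) measurable_const
  have hprob : ∀ k, ENNReal.ofReal (1 - δ) ≤ M.sampleLaw n (E k) := by
    intro k
    have h1 : M.gammaO n H fstar r (ρ k) τ δ / ENNReal.ofReal (ρ k) < ENNReal.ofReal lam :=
      (le_iSup (fun ρ : {ρ : ℝ // 0 < ρ} => M.gammaO n H fstar r ρ τ δ / ENNReal.ofReal ρ)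
        ⟨ρ k, hρ0 k⟩).trans_lt hlam
    rw [ENNReal.div_lt_iff (Or.inl (by simpa using hρ0 k)) (Or.inl ENNReal.ofReal_ne_top),
      ← ENNReal.ofReal_mul' (hρ0 k).le] at h1
    -- The infimum in `gammaO` need not be attained; the strict inequality on `lam` leaves room for
    -- an admissible `z < lam * ρ k`.
    obtain ⟨_, ⟨z, ⟨hz0, hz⟩, rfl⟩, hzlt⟩ := sInf_lt_iff.1 h1
    have hz' : z < lam * ρ k := (ENNReal.ofReal_lt_ofReal_iff_of_nonneg hz0.le).1 hzlt
    refine hz.trans (measure_mono fun S hS => ?_)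
    change O k S ≤ _
    refine iSup_le fun f => ?_
    have h2 : ENNReal.ofReal |dev f.1 S| ≤ M.multSup n H fstar r (ρ k) S := by
      refine le_iSup₂_of_le f.1 (mem_localClass_of_gap_pos f.2.1 f.2.2 (hρr k).le) ?_
      rw [Real.enorm_eq_ofReal_abs, ← M.noiseMean_toL2_sub]
    refine h2.trans (le_trans hS (ENNReal.ofReal_le_ofReal ?_))
    rw [mul_assoc]
    exact mul_le_mul_of_nonneg_left hz'.le hτ.le
  have : IsProbabilityMeasure (M.sampleLaw n) := by unfold sampleLaw; infer_instance
  refine ⟨_, measurableSet_frequently hE, le_measure_frequently hE hprob, ?_⟩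
  intro S hS f hf ψ hψ hfψ
  -- Shrinking `f` by `t = ρ k / ψ` brings the penalty excess below `ρ k`. The first term of the
  -- maximum ensures `t ≤ 1`, the second that the shrunk norm is below `k ρ k`.
  obtain ⟨K, hK⟩ := exists_nat_gt (max (1 / ψ) (‖M.toL2 f - M.toL2 fstar‖ / ψ))
  obtain ⟨k, hkS, hk⟩ := (Filter.Frequently.and_eventually hS
    (Filter.eventually_ge_atTop K)).exists
  have hk' : max (1 / ψ) (‖M.toL2 f - M.toL2 fstar‖ / ψ) < k :=
    hK.trans_le (by exact_mod_cast hk)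
  obtain ⟨hk1, hk2⟩ := max_lt_iff.1 hk'
  let t : ℝ := ρ k / ψ
  have ht0 : 0 < t := div_pos (hρ0 k) hψ
  have ht1 : t ≤ 1 := by
    rw [div_le_one hψ]
    refine (hρ1 k).le.trans ?_
    rw [div_lt_iff₀ hψ] at hk1
    rw [div_le_iff₀ (by positivity)]
    nlinarith
  have hgap : 0 < M.gap fstar (ρ k) (k * ρ k)
      (M.toL2 (M.seg fstar f t), M.D (M.seg fstar f t)) := by
    rw [gap_pos_iff]
    constructor
    · refine (M.Psi_seg_sub_le fstar f ht0.le ht1).trans_lt ?_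
      calc t * (M.Psi f - M.Psi fstar) < t * ψ := mul_lt_mul_of_pos_left hfψ ht0
        _ = ρ k := div_mul_cancel₀ _ hψ.ne'
    · rw [M.norm_toL2_seg_sub fstar f ht0.le]
      rw [div_lt_iff₀ hψ] at hk2
      calc t * ‖M.toL2 f - M.toL2 fstar‖ < t * (k * ψ) := mul_lt_mul_of_pos_left hk2 ht0
        _ = k * (t * ψ) := by ring
        _ = k * ρ k := by rw [div_mul_cancel₀ _ hψ.ne']
  have h1 : ENNReal.ofReal |dev (M.seg fstar f t) S| ≤ ENNReal.ofReal (τ * lam * ρ k) :=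
    (le_iSup (fun f : ι k => ENNReal.ofReal |dev f.1 S|)
      ⟨M.seg fstar f t, M.seg_mem_hull htarget.1 hf ht0.le ht1, hgap⟩).trans hkS
  have hlam0 : 0 < lam := ENNReal.ofReal_pos.1 (pos_of_gt hlam)
  have hrk := hρ0 k
  rw [ENNReal.ofReal_le_ofReal_iff (by positivity)] at h1
  have h2 : dev (M.seg fstar f t) S = t * dev f S := by
    simp only [dev, seg_apply, toL2_seg_sub]
    have h3 : M.noiseMean fstar (t • (M.toL2 f - M.toL2 fstar))
        = t * M.noiseMean fstar (M.toL2 f - M.toL2 fstar) := by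
      rw [noiseMean, noiseMean, ← integral_const_mul]
      refine integral_congr_ae ?_
      filter_upwards [M.measurePreserving_fst_law.quasiMeasurePreserving.ae
        (Lp.coeFn_smul t (M.toL2 f - M.toL2 fstar))] with z hz
      rw [hz, Pi.smul_apply, smul_eq_mul]
      ring
    rw [h3, mul_sub, mul_left_comm t, Finset.mul_sum Finset.univ _ t]
    congr 2
    exact Finset.sum_congr rfl fun i _ => by ring
  rw [h2, abs_mul, abs_of_pos ht0] at h1
  have h4 : t * |dev f S| ≤ t * (τ * lam * ψ) := by
    refine h1.trans (le_of_eq ?_)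
    simp only [t]
    field_simp
  have h5 := (abs_le.1 (le_of_mul_le_mul_left h4 ht0)).1
  -- By optimality the mean is nonnegative, so the lower bound survives without centring.
  have h6 := htarget.noiseMean_nonneg hf
  simp only [dev] at h5
  linarith

/-- If the complexities `r_M` of the classes of penalty `ρ → 0` are of order at most `ρ`, then the
multiplier process vanishes with high probability. -/
theorem exists_multiplier_event_of_le {H : Set M.V} (hmeas : M.MeasurableSuprema H) {fstar : M.V}
    (hstar : M.toL2 fstar ∈ M.hull H) {n : ℕ} (hn : 0 < n) {δ τ : ℝ} (hδ : 0 < δ) (hδ1 : δ < 1)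
    (hτ : 0 ≤ τ) {C η : ℝ} (hC : 0 ≤ C) (hη : 0 < η)
    (hr : ∀ ρ : ℝ, 0 < ρ → ρ < η →
      M.rM n (M.penaltyClass H fstar ρ) fstar τ (δ / 4) ≤ ENNReal.ofReal (C * ρ)) :
    ∃ E : Set (Fin n → 𝓧 × ℝ), MeasurableSet E ∧ ENNReal.ofReal (1 - δ) ≤ M.sampleLaw n E ∧
      ∀ S ∈ E, ∀ f : M.V, M.toL2 f ∈ M.hull H → ∀ i, M.noise fstar (S i) *
          ((f : 𝓧 → ℝ) (S i).1 - (fstar : 𝓧 → ℝ) (S i).1) = 0 := by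
  have hn' : (0 : ℝ) < n := by exact_mod_cast hn
  -- The shift by 2 keeps `ρ 0` strictly below `η`.
  let ρ : ℕ → ℝ := fun j => η / (j + 2)
  have hρ0 : ∀ j, 0 < ρ j := fun j => by positivity
  have hρη : ∀ j, ρ j < η := fun j => by
    refine div_lt_self hη ?_
    have : (0 : ℝ) ≤ j := by positivity
    linarith
  have hs : ∀ j, ∃ s : ℝ, 0 < s ∧ s < (C + 1) * ρ j ∧ ENNReal.ofReal (1 - δ / 4)
      ≤ M.signSampleLaw n {p | M.phi n (M.penaltyClass H fstar (ρ j)) fstar (ENNReal.ofReal s) p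
        ≤ ENNReal.ofReal (τ * s ^ 2 * √(n : ℝ))} := by
    intro j
    -- `C + 1` instead of `C` makes the inequality strict, so an admissible radius exists below it.
    have h1 : M.rM n (M.penaltyClass H fstar (ρ j)) fstar τ (δ / 4)
        < ENNReal.ofReal ((C + 1) * ρ j) := by
      refine (hr _ (hρ0 j) (hρη j)).trans_lt ((ENNReal.ofReal_lt_ofReal_iff ?_).2 ?_)
      · have := hρ0 j
        positivity
      · have := hρ0 j
        linarith
    obtain ⟨_, ⟨s, ⟨hs0, hs⟩, rfl⟩, hslt⟩ := sInf_lt_iff.1 h1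
    exact ⟨s, hs0, (ENNReal.ofReal_lt_ofReal_iff_of_nonneg hs0.le).1 hslt, hs⟩
  choose s hs0 hslt hsp using hs
  have hslim : Filter.Tendsto s Filter.atTop (nhds 0) := by
    refine squeeze_zero (fun j => (hs0 j).le) (fun j => (hslt j).le) ?_
    have h1 : Filter.Tendsto ρ Filter.atTop (nhds 0) :=
      tendsto_const_nhds.div_atTop
        (Filter.tendsto_atTop_add_const_right _ _ tendsto_natCast_atTop_atTop)
    simpa using h1.const_mul (C + 1)
  let ι : ℕ → Type _ := fun j =>
    {f : M.V // M.toL2 f ∈ M.hull H ∧ 0 < M.gap fstar (ρ j) (s j) (M.toL2 f, M.D f)}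
  let proc : M.V → (Fin n → Bool) → (Fin n → 𝓧 × ℝ) → ℝ := fun f σ S =>
    (√(n : ℝ))⁻¹ * ∑ i, sign (σ i) * M.noise fstar (S i) *
      ((f : 𝓧 → ℝ) (S i).1 - (fstar : 𝓧 → ℝ) (S i).1)
  let G : ℕ → (Fin n → Bool) → (Fin n → 𝓧 × ℝ) → ℝ≥0∞ := fun j σ S =>
    ⨆ f : ι j, ENNReal.ofReal |proc f.1 σ S|
  have hG : ∀ j σ, Measurable (G j σ) := fun j σ =>
    hmeas.measurable_iSup n (fun S v => |(√(n : ℝ))⁻¹ * ∑ i, sign (σ i) * M.noise fstar (S i) *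
        (v.1 i - (fstar : 𝓧 → ℝ) (S i).1)|)
      (fun v => by
        have h1 := M.measurable_coe fstar
        have h2 := M.measurable_noise fstar
        refine (Measurable.const_mul (Finset.measurable_sum _ fun i _ => ?_) _).abs
        fun_prop)
      (fun S => by fun_prop) _ (continuous_gap fstar _ _)
  have hG' : ∀ j, Measurable fun p : (Fin n → Bool) × (Fin n → 𝓧 × ℝ) => G j p.1 p.2 := fun j =>
    measurable_from_prod_countable_right fun σ => hG j σ
  let B : ℕ → Set ((Fin n → Bool) × (Fin n → 𝓧 × ℝ)) := fun j =>
    {p | G j p.1 p.2 ≤ ENNReal.ofReal (τ * s j ^ 2 * √(n : ℝ))}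
  have hB : ∀ j, MeasurableSet (B j) := fun j => measurableSet_le (hG' j) measurable_const
  have hBp : ∀ j, ENNReal.ofReal (1 - δ / 4) ≤ M.signSampleLaw n (B j) := by
    intro j
    refine (hsp j).trans (measure_mono fun p hp => ?_)
    change G j p.1 p.2 ≤ _
    refine le_trans (iSup_le fun f => ?_) hp
    refine le_iSup₂_of_le f.1 (mem_localClass_of_gap_pos f.2.1 f.2.2 le_rfl) ?_
    rw [Real.enorm_eq_ofReal_abs]
  have : IsProbabilityMeasure (M.sampleLaw n) := by unfold sampleLaw; infer_instance
  have : IsProbabilityMeasure (M.signSampleLaw n) := by unfold signSampleLaw; infer_instance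
  let U := {p | ∃ᶠ j in Filter.atTop, p ∈ B j}
  have hU : MeasurableSet U := measurableSet_frequently hB
  have hUp : ENNReal.ofReal (1 - δ / 4) ≤ M.signSampleLaw n U := le_measure_frequently hB hBp
  have hU0 : ∀ p ∈ U, ∀ f : M.V, M.toL2 f ∈ M.hull H → proc f p.1 p.2 = 0 := by
    intro p hp f hf
    -- With this `K`, shrinking `f` by `s j / K` meets the norm constraint, the penalty constraint
    -- (through `s j < (C + 1) ρ j`) and `t ≤ 1`.
    let K : ℝ := 1 + ‖M.toL2 f - M.toL2 fstar‖ + (C + 1) * |M.Psi f - M.Psi fstar| + (C + 1) * η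
    have hK : 0 < K := by positivity
    have hK1 : ‖M.toL2 f - M.toL2 fstar‖ < K := by
      have h1 : 0 ≤ (C + 1) * |M.Psi f - M.Psi fstar| := by positivity
      have h2 : 0 ≤ (C + 1) * η := by positivity
      simp only [K]
      linarith
    have hK2 : (C + 1) * |M.Psi f - M.Psi fstar| ≤ K := by
      have h1 : 0 ≤ ‖M.toL2 f - M.toL2 fstar‖ := norm_nonneg _
      have h2 : 0 ≤ (C + 1) * η := by positivity
      simp only [K]
      linarith
    have hK3 : (C + 1) * η ≤ K := by
      have h1 : 0 ≤ ‖M.toL2 f - M.toL2 fstar‖ := norm_nonneg _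
      have h2 : 0 ≤ (C + 1) * |M.Psi f - M.Psi fstar| := by positivity
      simp only [K]
      linarith
    -- The process is linear in the shrinking factor, of order `s j`, but bounded by a multiple of
    -- `s j ^ 2`; dividing leaves a bound of order `s j → 0`.
    have key : ∀ j, p ∈ B j → |proc f p.1 p.2| ≤ K * (τ * √(n : ℝ)) * s j := by
      intro j hj
      let t : ℝ := s j / K
      have ht0 : 0 < t := div_pos (hs0 j) hK
      have ht1 : t ≤ 1 := (div_le_one hK).2 ((hslt j).le.trans
        ((mul_le_mul_of_nonneg_left (hρη j).le (by positivity)).trans hK3))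
      have hgap : 0 < M.gap fstar (ρ j) (s j)
          (M.toL2 (M.seg fstar f t), M.D (M.seg fstar f t)) := by
        rw [gap_pos_iff]
        constructor
        · refine (M.Psi_seg_sub_le fstar f ht0.le ht1).trans_lt ?_
          have h1 : t < (C + 1) * ρ j / K := div_lt_div_of_pos_right (hslt j) hK
          rcases le_or_gt (M.Psi f - M.Psi fstar) 0 with h0 | h0
          · exact (mul_nonpos_of_nonneg_of_nonpos ht0.le h0).trans_lt (hρ0 j)
          · calc t * (M.Psi f - M.Psi fstar)
                < (C + 1) * ρ j / K * (M.Psi f - M.Psi fstar) := mul_lt_mul_of_pos_right h1 h0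
              _ = ρ j * ((C + 1) * |M.Psi f - M.Psi fstar| / K) := by
                  rw [abs_of_pos h0]
                  ring
              _ ≤ ρ j := mul_le_of_le_one_right (hρ0 j).le ((div_le_one hK).2 hK2)
        · rw [M.norm_toL2_seg_sub fstar f ht0.le]
          calc t * ‖M.toL2 f - M.toL2 fstar‖ < t * K := mul_lt_mul_of_pos_left hK1 ht0
            _ = s j := div_mul_cancel₀ _ hK.ne'
      have h1 : ENNReal.ofReal |proc (M.seg fstar f t) p.1 p.2|
          ≤ ENNReal.ofReal (τ * s j ^ 2 * √(n : ℝ)) :=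
        (le_iSup (fun f : ι j => ENNReal.ofReal |proc f.1 p.1 p.2|)
          ⟨M.seg fstar f t, M.seg_mem_hull hstar hf ht0.le ht1, hgap⟩).trans hj
      rw [ENNReal.ofReal_le_ofReal_iff (by positivity)] at h1
      have h2 : proc (M.seg fstar f t) p.1 p.2 = t * proc f p.1 p.2 := by
        simp only [proc, seg_apply]
        rw [mul_left_comm t, Finset.mul_sum Finset.univ _ t]
        congr 1
        exact Finset.sum_congr rfl fun i _ => by ring
      rw [h2, abs_mul, abs_of_pos ht0] at h1
      refine le_of_mul_le_mul_left (h1.trans (le_of_eq ?_)) ht0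
      simp only [t]
      field_simp
    have hlim : Filter.Tendsto (fun j => K * (τ * √(n : ℝ)) * s j) Filter.atTop (nhds 0) := by
      simpa using hslim.const_mul (K * (τ * √(n : ℝ)))
    exact abs_nonpos_iff.1 (ge_of_tendsto_of_frequently hlim (hp.mono key))
  -- A single supremum encodes the vanishing of all products, which makes that event measurable.
  let N : (Fin n → 𝓧 × ℝ) → ℝ≥0∞ := fun S =>
    ⨆ f : {f : M.V // M.toL2 f ∈ M.hull H ∧ (0 : ℝ) < 1}, ENNReal.ofReal
      (∑ i, |M.noise fstar (S i) * ((f.1 : 𝓧 → ℝ) (S i).1 - (fstar : 𝓧 → ℝ) (S i).1)|)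
  have hN : Measurable N :=
    hmeas.measurable_iSup n (fun S v => ∑ i, |M.noise fstar (S i) *
        (v.1 i - (fstar : 𝓧 → ℝ) (S i).1)|)
      (fun v => by
        have h1 := M.measurable_coe fstar
        have h2 := M.measurable_noise fstar
        refine Finset.measurable_sum _ fun i _ => Measurable.abs ?_
        fun_prop)
      (fun S => by fun_prop) (fun _ => 1) continuous_const
  let E : Set (Fin n → 𝓧 × ℝ) := {S | N S = 0}
  have hE : MeasurableSet E := hN (measurableSet_singleton 0)
  have hE0 : ∀ S, S ∈ E ↔ ∀ f : M.V, M.toL2 f ∈ M.hull H → ∀ i, M.noise fstar (S i) *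
      ((f : 𝓧 → ℝ) (S i).1 - (fstar : 𝓧 → ℝ) (S i).1) = 0 := by
    intro S
    have h1 : ∀ f : M.V, (∑ i, |M.noise fstar (S i) *
        ((f : 𝓧 → ℝ) (S i).1 - (fstar : 𝓧 → ℝ) (S i).1)| ≤ 0) ↔ ∀ i, M.noise fstar (S i) *
        ((f : 𝓧 → ℝ) (S i).1 - (fstar : 𝓧 → ℝ) (S i).1) = 0 := by
      intro f
      rw [(Finset.sum_nonneg fun i _ => abs_nonneg _).ge_iff_eq',
        Finset.sum_eq_zero_iff_of_nonneg fun i _ => abs_nonneg _]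
      simp
    simp only [E, N, Set.mem_ofPred_eq, ENNReal.iSup_eq_zero, ENNReal.ofReal_eq_zero, h1]
    exact ⟨fun h f hf => h ⟨f, hf, one_pos⟩, fun h f => h f.1 f.2.1⟩
  refine ⟨E, hE, ?_, fun S hS => (hE0 S).1 hS⟩
  -- Off `E` some product is nonzero, and then at most half of the sign vectors can annihilate the
  -- process.
  have hsec : ∀ S, (PMF.uniformOfFintype (Fin n → Bool)).toMeasure ((fun σ => (σ, S)) ⁻¹' U)
      ≤ E.indicator 1 S + 2⁻¹ * Eᶜ.indicator 1 S := by
    intro S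
    by_cases hS : S ∈ E
    · simp only [Set.indicator_of_mem hS, Pi.one_apply]
      exact le_add_right prob_le_one
    · rw [Set.indicator_of_notMem hS, Set.indicator_of_mem (Set.mem_compl hS), Pi.one_apply,
        mul_one, zero_add]
      rw [hE0] at hS
      push Not at hS
      obtain ⟨f, hf, i, hi⟩ := hS
      refine le_trans (measure_mono fun σ hσ => ?_) (toMeasure_sum_sign_eq_zero_le
        (fun j => M.noise fstar (S j) * ((f : 𝓧 → ℝ) (S j).1 - (fstar : 𝓧 → ℝ) (S j).1)) hi)
      have h1 := hU0 (σ, S) hσ f hf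
      simp only [proc] at h1
      rcases mul_eq_zero.1 h1 with h | h
      · exact absurd h (by positivity)
      · simpa only [Set.mem_ofPred_eq, mul_assoc] using h
  have hUle : M.signSampleLaw n U ≤ M.sampleLaw n E + 2⁻¹ * M.sampleLaw n Eᶜ := by
    have : SFinite (M.sampleLaw n) := inferInstance
    rw [signSampleLaw, Measure.prod_apply_symm hU]
    refine (lintegral_mono hsec).trans (le_of_eq ?_)
    rw [lintegral_add_left (measurable_one.indicator hE),
      lintegral_const_mul _ (measurable_one.indicator hE.compl), lintegral_indicator_one hE,
      lintegral_indicator_one hE.compl]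
  -- With `p` the probability of `E`, `1 - δ/4 ≤ p + (1 - p)/2` gives `p ≥ 1 - δ/2`.
  have h1 := ENNReal.toReal_mono (by finiteness) (hUp.trans hUle)
  rw [ENNReal.toReal_ofReal (by linarith), ENNReal.toReal_add (by finiteness) (by finiteness),
    ENNReal.toReal_mul, ENNReal.toReal_inv, ENNReal.toReal_ofNat] at h1
  change 1 - δ / 4 ≤ (M.sampleLaw n).real E + 2⁻¹ * (M.sampleLaw n).real Eᶜ at h1
  rw [probReal_compl_eq_one_sub hE] at h1
  refine (ENNReal.ofReal_le_iff_le_toReal (measure_ne_top _ _)).2 ?_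
  change 1 - δ ≤ (M.sampleLaw n).real E
  linarith

end Model

end PISL

end

/-! ### The two events and the basic inequality. -/

noncomputable section

namespace PISL

namespace Model

variable {𝓧 : Type*} [MeasurableSpace 𝓧] {M : Model 𝓧}

/-- With high probability the multiplier process at `f` is at least `-τ λ (Ψ(f) - Ψ(f*))₊`. -/
theorem exists_multiplier_event {H : Set M.V} (hmeas : M.MeasurableSuprema H) {fstar : M.V}
    (htarget : M.IsTarget H fstar) {n : ℕ} (hn : 0 < n) {δ τ τ' lam : ℝ} (hδ : 0 < δ)
    (hδ1 : δ < 1) (hτ : 0 < τ) (hτ' : 0 ≤ τ') {r : ℝ → ℝ≥0∞}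
    (hlam : M.lambda0 n H fstar r δ τ < ENNReal.ofReal lam)
    (hr : ∀ ρ : ℝ, 0 ≤ ρ → M.rM n (M.penaltyClass H fstar ρ) fstar τ' (δ / 4) ≤ r ρ) :
    ∃ E : Set (Fin n → 𝓧 × ℝ), MeasurableSet E ∧ ENNReal.ofReal (1 - δ) ≤ M.sampleLaw n E ∧
      ∀ S ∈ E, ∀ f : M.V, M.toL2 f ∈ M.hull H → ∀ ψ : ℝ, 0 < ψ → M.Psi f - M.Psi fstar < ψ →
        -(τ * lam * ψ) ≤ (n : ℝ)⁻¹ * ∑ i, M.noise fstar (S i) *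
          ((f : 𝓧 → ℝ) (S i).1 - (fstar : 𝓧 → ℝ) (S i).1) := by
  -- Dichotomy: either `r ρ / ρ` is unbounded as `ρ → 0`, or `r ρ ≤ k ρ` for all small `ρ`.
  by_cases hII : ∀ k : ℕ, ∃ ρ : ℝ, 0 < ρ ∧ ρ < 1 / (k + 1) ∧ ENNReal.ofReal (k * ρ) < r ρ
  · exact exists_multiplier_event_of_lt hmeas htarget hτ hlam hII
  · push Not at hII
    obtain ⟨k, hk⟩ := hII
    have hlam0 : 0 < lam := ENNReal.ofReal_pos.1 (pos_of_gt hlam)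
    obtain ⟨E, hE, hEp, hE0⟩ := exists_multiplier_event_of_le hmeas htarget.1 hn hδ hδ1 hτ'
      (C := k) (η := 1 / (k + 1)) (by positivity) (by positivity)
      fun ρ h0 h1 => (hr ρ h0.le).trans (hk ρ h0 h1)
    refine ⟨E, hE, hEp, fun S hS f hf ψ hψ _ => ?_⟩
    rw [Finset.sum_eq_zero fun i _ => hE0 S hS f hf i, mul_zero, neg_nonpos]
    positivity

/-- With high probability the quadratic process dominates the squared norm above `r_Q`. -/
theorem SmallBall.exists_quadratic_event {H : Set M.V} {κ ε : ℝ}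
    (hSB : M.SmallBall (M.hull H) κ ε) (hκ : 0 < κ) (hε : 0 < ε) (hmeas : M.MeasurableSuprema H)
    {fstar : M.V} (hstar : M.toL2 fstar ∈ M.hull H) {n : ℕ} (hn : 0 < n) {ρ : ℝ} (hρ : 0 < ρ)
    {r : ℝ≥0∞} (hr : M.rQ n (M.penaltyClass H fstar ρ) fstar (κ * ε / 32) ≤ r) :
    ∃ E : Set (Fin n → 𝓧 × ℝ), MeasurableSet E ∧
      ENNReal.ofReal (1 - Real.exp (-(n * ε ^ 2 / 2))) ≤ M.sampleLaw n E ∧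
      ∀ S ∈ E, ∀ f : M.V, M.toL2 f ∈ M.hull H → M.Psi f - M.Psi fstar < ρ →
        r < ‖M.toL2 f - M.toL2 fstar‖ₑ →
        κ ^ 2 * ε / 16 * ‖M.toL2 f - M.toL2 fstar‖ ^ 2
          ≤ (n : ℝ)⁻¹ * ∑ i, ((f : 𝓧 → ℝ) (S i).1 - (fstar : 𝓧 → ℝ) (S i).1) ^ 2 := by
  have : IsProbabilityMeasure (M.sampleLaw n) := by unfold sampleLaw; infer_instance
  rcases eq_or_ne r ∞ with rfl | hrtop
  · refine ⟨Set.univ, MeasurableSet.univ, ?_, fun S _ f _ _ h => absurd h not_top_lt⟩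
    rw [measure_univ, ← ENNReal.ofReal_one]
    exact ENNReal.ofReal_le_ofReal (by linarith [Real.exp_pos (-(n * ε ^ 2 / 2))])
  -- The infimum `rQ` need not be attained, so admissible radii below `r + 1 / (j + 1)` are used;
  -- any norm strictly above `r` exceeds them eventually.
  have hs : ∀ j : ℕ, ∃ s : ℝ, 0 < s ∧ s < r.toReal + 1 / (j + 1) ∧
      ∫⁻ p, M.radSup n (M.penaltyClass H fstar ρ) fstar (ENNReal.ofReal s) p
        ∂M.signSampleLaw n ≤ ENNReal.ofReal (κ * ε / 32 * s) := by
    intro j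
    have h1 : M.rQ n (M.penaltyClass H fstar ρ) fstar (κ * ε / 32)
        < ENNReal.ofReal (r.toReal + 1 / (j + 1)) := by
      refine hr.trans_lt ((ENNReal.lt_ofReal_iff_toReal_lt hrtop).2 ?_)
      have : (0 : ℝ) < 1 / (j + 1) := by positivity
      linarith
    obtain ⟨_, ⟨s, ⟨hs0, hs⟩, rfl⟩, hslt⟩ := sInf_lt_iff.1 h1
    exact ⟨s, hs0, (ENNReal.ofReal_lt_ofReal_iff_of_nonneg hs0.le).1 hslt, hs⟩
  choose s hs0 hslt hsr using hs
  choose E hE hEp hEQ using fun j =>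
    hSB.exists_event hκ hε hmeas hstar hn hρ (hs0 j) (hsr j)
  refine ⟨_, measurableSet_frequently hE, le_measure_frequently hE fun j =>
    (ENNReal.ofReal_le_iff_le_toReal (measure_ne_top _ _)).2 (hEp j), ?_⟩
  intro S hS f hf hfρ hfr
  have hd : r.toReal < ‖M.toL2 f - M.toL2 fstar‖ := by
    rw [← ofReal_norm] at hfr
    exact (ENNReal.lt_ofReal_iff_toReal_lt hrtop).1 hfr
  obtain ⟨J, hJ⟩ := exists_nat_one_div_lt (sub_pos.2 hd)
  obtain ⟨j, hjS, hj⟩ := (Filter.Frequently.and_eventually hS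
    (Filter.eventually_ge_atTop J)).exists
  refine hEQ j S hjS f hf hfρ ?_
  have h1 : (1 : ℝ) / (j + 1) ≤ 1 / (J + 1) :=
    one_div_le_one_div_of_le (by positivity) (by exact_mod_cast Nat.succ_le_succ hj)
  linarith [hslt j]

/-- The basic inequality for an estimator, on the event controlling the multiplier process. -/
theorem IsInformedEstimator.Psi_le_and_le {H : Set M.V} {fstar h : M.V} (hfstar : fstar ∈ H)
    {n : ℕ} {lam τ : ℝ} (hlam : 0 < lam) (hτ : 0 < τ) (hτ2 : τ < 1 / 2) {S : Fin n → 𝓧 × ℝ}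
    (hh : M.IsInformedEstimator n H lam S h)
    (hmult : ∀ ψ : ℝ, 0 < ψ → M.Psi h - M.Psi fstar < ψ →
        -(τ * lam * ψ) ≤ (n : ℝ)⁻¹ * ∑ i, M.noise fstar (S i) *
          ((h : 𝓧 → ℝ) (S i).1 - (fstar : 𝓧 → ℝ) (S i).1)) :
    M.Psi h ≤ M.Psi fstar ∧
      (n : ℝ)⁻¹ * ∑ i, ((h : 𝓧 → ℝ) (S i).1 - (fstar : 𝓧 → ℝ) (S i).1) ^ 2
        ≤ lam * M.Psi fstar := by
  set Q := (n : ℝ)⁻¹ * ∑ i, ((h : 𝓧 → ℝ) (S i).1 - (fstar : 𝓧 → ℝ) (S i).1) ^ 2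
  set L := (n : ℝ)⁻¹ * ∑ i, M.noise fstar (S i) *
          ((h : 𝓧 → ℝ) (S i).1 - (fstar : 𝓧 → ℝ) (S i).1)
  have hQ : 0 ≤ Q := by positivity
  have h1 := hh.2 fstar hfstar
  have h2 : (n : ℝ)⁻¹ * ∑ i, ((h : 𝓧 → ℝ) (S i).1 - (S i).2) ^ 2
      = (n : ℝ)⁻¹ * ∑ i, ((fstar : 𝓧 → ℝ) (S i).1 - (S i).2) ^ 2 + (Q + 2 * L) := by
    simp only [Q, L]
    rw [mul_left_comm 2, ← mul_add, ← mul_add, Finset.mul_sum Finset.univ _ 2,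
      ← Finset.sum_add_distrib, ← Finset.sum_add_distrib]
    congr 1
    refine Finset.sum_congr rfl fun i _ => ?_
    simp only [noise]
    ring
  have h3 : Q + 2 * L + lam * (M.Psi h - M.Psi fstar) ≤ 0 := by
    simp only [informedLoss] at h1
    rw [h2] at h1
    linarith
  have hΨ : M.Psi h ≤ M.Psi fstar := by
    by_contra hlt
    push Not at hlt
    have hψ : 0 < M.Psi h - M.Psi fstar := sub_pos.2 hlt
    -- With `Δ = Ψ(h) - Ψ(f*)`, a test value `ψ > Δ` with `2τψ < Δ` is needed; the midpoint of `Δ`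
    -- and `Δ / (2τ)` serves, as `2τ < 1`.
    have hψτ : M.Psi h - M.Psi fstar < (M.Psi h - M.Psi fstar) / (2 * τ) := by
      rw [lt_div_iff₀ (by positivity)]
      exact mul_lt_of_lt_one_right hψ (by linarith)
    have h4 := hmult ((M.Psi h - M.Psi fstar + (M.Psi h - M.Psi fstar) / (2 * τ)) / 2)
      (by positivity) (by linarith)
    have h5 : τ * lam * ((M.Psi h - M.Psi fstar + (M.Psi h - M.Psi fstar) / (2 * τ)) / 2)
        = lam * (M.Psi h - M.Psi fstar) * (τ / 2 + 1 / 4) := by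
      field_simp
      ring
    have h6 : lam * (M.Psi h - M.Psi fstar) * (τ / 2 + 1 / 4)
        < lam * (M.Psi h - M.Psi fstar) * (1 / 2) :=
      mul_lt_mul_of_pos_left (by linarith) (by positivity)
    linarith
  have hL : 0 ≤ L := by
    by_contra hneg
    push Not at hneg
    -- This `ψ` turns the bound into `L / 2 ≤ L`, impossible for negative `L`.
    have h4 := hmult (-L / (2 * (τ * lam))) (div_pos (by linarith) (by positivity))
      (by
        have : 0 < -L / (2 * (τ * lam)) := div_pos (by linarith) (by positivity)
        linarith)
    have h5 : τ * lam * (-L / (2 * (τ * lam))) = -L / 2 := by field_simp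
    linarith
  refine ⟨hΨ, ?_⟩
  have h6 := mul_nonneg hlam.le (M.Psi_nonneg h)
  linarith

end Model

end PISL

end

/-! ### The main theorem. -/

theorem theorem2 {𝓧 : Type*} [MeasurableSpace 𝓧] (M : PISL.Model 𝓧)
    -- the class, its closed convex hull and the target
    (H : Set M.V) (κ ε : ℝ) (hκ : 0 < κ) (hε : 0 < ε) (hε1 : ε ≤ 1)
    (hSB : M.SmallBall (M.hull H) κ ε)
    (hmeas : M.MeasurableSuprema H)
    (fstar : M.V) (htarget : M.IsTarget H fstar) (hfstar : fstar ∈ H)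
    -- the sample size, the confidence parameter and the bound on the local complexities
    (n : ℕ) (δ : ℝ) (hδ0 : 0 < δ) (hδ1 : δ < 1)
    (r : ℝ → ℝ≥0∞)
    (hr : ∀ ρ : ℝ, 0 ≤ ρ →
      max (M.rM n (M.penaltyClass H fstar ρ) fstar (κ ^ 2 * ε / 80) (δ / 4))
        (M.rQ n (M.penaltyClass H fstar ρ) fstar (κ * ε / 32)) ≤ r ρ)
    -- the choice of `ρ`, `τ` and of the regularization parameter
    (ρ : ℝ) (hρ : 2 * M.Psi fstar < ρ)
    (τ : ℝ) (hτ0 : 0 < τ) (hτ : τ < 1 / 2 - M.Psi fstar / ρ)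
    (lam : ℝ) (hlam : M.lambda0 n H fstar r δ τ < ENNReal.ofReal lam)
    -- an independent sample of `(X, Y)`
    {Ω : Type*} [MeasurableSpace Ω] (P : Measure Ω) [IsProbabilityMeasure P]
    (Z : Fin n → Ω → 𝓧 × ℝ) (hZ : ∀ i, Measurable (Z i))
    (hlaw : ∀ i, P.map (Z i) = M.law) (hindep : iIndepFun Z P) :
    ∃ A : Set Ω, MeasurableSet A ∧
      1 - 2 * δ - 2 * Real.exp (-(n * ε ^ 2 / 2)) ≤ P.real A ∧
      ∀ ω ∈ A, ∀ hhat : M.V, M.IsInformedEstimator n H lam (fun i => Z i ω) hhat →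
        M.Psi hhat - M.Psi fstar ≤ ρ ∧
        ‖M.toL2 hhat - M.toL2 fstar‖ₑ ≤
          max (r ρ) (ENNReal.ofReal (√(32 / (κ ^ 2 * ε) * lam * M.Psi fstar))) := by

  -- Without observations the exponential equals 1 and the claimed probability is negative.
  rcases Nat.eq_zero_or_pos n with rfl | hn
  · refine ⟨∅, MeasurableSet.empty, ?_, fun ω hω => absurd hω (Set.notMem_empty ω)⟩
    simp
    linarith
  have hΨ0 := M.Psi_nonneg fstar
  have hρ0 : 0 < ρ := by linarith
  have hτ2 : τ < 1 / 2 := by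
    have : 0 ≤ M.Psi fstar / ρ := div_nonneg hΨ0 hρ0.le
    linarith
  have hlam0 : 0 < lam := ENNReal.ofReal_pos.1 (pos_of_gt hlam)
  obtain ⟨E₁, hE₁, hp₁, hmult⟩ := PISL.Model.exists_multiplier_event hmeas htarget hn hδ0 hδ1 hτ0
    (by positivity) hlam fun ρ hρ => (le_max_left _ _).trans (hr ρ hρ)
  obtain ⟨E₂, hE₂, hp₂, hquad⟩ := hSB.exists_quadratic_event hκ hε hmeas htarget.1 hn hρ0
    ((le_max_right _ _).trans (hr ρ hρ0.le))
  have hsample : P.map (fun ω i => Z i ω) = M.sampleLaw n := by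
    rw [(iIndepFun_iff_map_fun_eq_pi_map fun i => (hZ i).aemeasurable).1 hindep]
    simp only [hlaw]
    rfl
  have hZm : Measurable fun ω i => Z i ω := measurable_pi_lambda _ hZ
  have : IsProbabilityMeasure (M.sampleLaw n) := by unfold PISL.Model.sampleLaw; infer_instance
  refine ⟨(fun ω i => Z i ω) ⁻¹' (E₁ ∩ E₂), hZm (hE₁.inter hE₂), ?_, ?_⟩
  · rw [← map_measureReal_apply hZm (hE₁.inter hE₂), hsample]
    have h₁ : 1 - δ ≤ (M.sampleLaw n).real E₁ :=
      (ENNReal.ofReal_le_iff_le_toReal (measure_ne_top _ _)).1 hp₁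
    have h₂ : 1 - Real.exp (-(n * ε ^ 2 / 2)) ≤ (M.sampleLaw n).real E₂ :=
      (ENNReal.ofReal_le_iff_le_toReal (measure_ne_top _ _)).1 hp₂
    have h₃ := measureReal_union_add_inter (μ := M.sampleLaw n) (s := E₁) hE₂
    have h₄ : (M.sampleLaw n).real (E₁ ∪ E₂) ≤ 1 := measureReal_le_one
    have h₅ := Real.exp_pos (-(n * ε ^ 2 / 2))
    linarith
  · rintro ω ⟨hω₁, hω₂⟩ h hh
    have hhull : M.toL2 h ∈ M.hull H :=
      subset_closure (subset_convexHull ℝ _ ⟨h, hh.1, rfl⟩)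
    obtain ⟨hΨ, hQ⟩ := hh.Psi_le_and_le hfstar hlam0 hτ0 hτ2 (hmult _ hω₁ h hhull)
    refine ⟨by linarith, ?_⟩
    by_contra hlt
    push Not at hlt
    obtain ⟨hlt₁, hlt₂⟩ := max_lt_iff.1 hlt
    -- This gives `κ² ε d² ≤ 16 λ Ψ(f*)`, against `κ² ε d² > 32 λ Ψ(f*)` from the negated
    -- conclusion.
    have h₁ := (hquad _ hω₂ h hhull (by linarith) hlt₁).trans hQ
    rw [← ofReal_norm] at hlt₂
    have h₂ := (Real.sqrt_lt' (ENNReal.ofReal_pos.1 (pos_of_gt hlt₂))).1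
      ((ENNReal.ofReal_lt_ofReal_iff_of_nonneg (Real.sqrt_nonneg _)).1 hlt₂)
    have h₃ : 32 / (κ ^ 2 * ε) * lam * M.Psi fstar * (κ ^ 2 * ε) = 32 * (lam * M.Psi fstar) := by
      field_simp
    have h₄ := mul_lt_mul_of_pos_right h₂ (by positivity : 0 < κ ^ 2 * ε)
    rw [h₃] at h₄
    have h₅ := mul_nonneg hlam0.le hΨ0
    linarith
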